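/- Let $F$ be a field of characteristic $0$, $d\in F^*$ not a square, $K=F(\sqrt d)$, $z\mapsto\overline z$ the nontrivial automorphism of $K/F$, and $\overline F$ an algebraic closure of $F$ containing $K$. For a matrix $X$ over $K$ put $X^*=\overline X^{T}$, and let $\mathfrak g=\mathfrak{su}(n,F,d)=\{A\in\mathfrak{sl}(n,K):A^*+A=0\}$, so that $\mathfrak g\otimes_F\overline F=\mathfrak{sl}(n,\overline F)$. A Lie bialgebra structure on a Lie algebra $\mathfrak a$ is a linear map $\delta:\mathfrak a\to\mathfrak a\otimes\mathfrak a$ whose transpose is a Lie bracket on $\mathfrak a^*$ and which satisfies $\delta([a,b])=a\cdot\delta(b)-b\cdot\delta(a)$, where $a\cdot t=(\mathrm{ad}_a\otimes1+1\otimes\mathrm{ad}_a)t$. For $r\in\mathfrak a\otimes\mathfrak a$ let $(\partial r)(a)=-a\cdot r$, and let $r^{21}$ be the image of $r$ under $a\otimes b\mapsto b\otimes a$. For $X\in\mathrm{GL}(n,\overline F)$ let $\mathrm{Ad}_X(A)=XAX^{-1}$. Two maps $\delta_1,\delta_2$ from $\mathfrak{sl}(n,\overline F)$ to its tensor square are gauge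 equivalent over $\overline F$ if $\delta_2=(\mathrm{Ad}_X\otimes\mathrm{Ad}_X)\circ\delta_1\circ\mathrm{Ad}_X^{-1}$ for some $X\in\mathrm{GL}(n,\overline F)$. For a field $E\supseteq F$ let $\mathfrak h_E\subset\mathfrak{sl}(n,E)$ be the diagonal Cartan subalgebra, with simple roots $\Gamma=\{\alpha_1,\dots,\alpha_{n-1}\}$, $\alpha_k(\mathrm{diag}(a_1,\dots,a_n))=a_k-a_{k+1}$, and let $\Omega_0=\sum_iE_{ii}\otimes E_{ii}-\frac1n\,I\otimes I$ be the Cartan part of the Casimir element of the trace form. An admissible triple $(\Gamma_1,\Gamma_2,\tau)$ consists of subsets $\Gamma_1,\Gamma_2\subseteq\Gamma$ and an isometric bijection $\tau:\Gamma_1\to\Gamma_2$ such that for each $\alpha\in\Gamma_1$ some power satisfies $\tau^k(\alpha)\notin\Gamma_1$. A Belavin--Drinfeld $r$-matrix over $\overline F$ associated with it is a solution $r_{BD}\in\mathfrak{sl}(n,\overline F)^{\otimes2}$ of the classical Yang--Baxter equation $[r_{12},r_{13}]+[r_{12},r_{23}]+[r_{13},r_{23}]=0$ of the form $$r_{BD}=r_0+\sum_{\alpha>0}e_\alpha\otimes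 e_{-\alpha}+\sum_{\alpha\in\mathrm{Span}(\Gamma_1)^+}\ \sum_{k\ge1}e_\alpha\wedge e_{-\tau^k(\alpha)},$$ where $\tau$ is extended additively and the inner sum runs over the $k$ for which $\tau^k(\alpha)$ is defined, $a\wedge b=a\otimes b-b\otimes a$, the $e_\alpha$ are root vectors with $\mathrm{tr}(e_\alpha e_{-\alpha})=1$, and $r_0\in\mathfrak h_{\overline F}\otimes\mathfrak h_{\overline F}$ satisfies $r_0+r_0^{21}=\Omega_0$ and $(\tau(\alpha)\otimes\mathrm{Id}+\mathrm{Id}\otimes\alpha)(r_0)=0$ for all $\alpha\in\Gamma_1$. Let $r_{DJ}=\frac12\Omega_0+\sum_{i<j}E_{ij}\otimes E_{ji}$. **Proposition.** Let $r_{BD}$ be a Belavin--Drinfeld $r$-matrix over $\overline F$ associated with $(\Gamma_1,\Gamma_2,\tau)$, and let $\delta$ be a Lie bialgebra structure on $\mathfrak g$ whose $\overline F$-linear extension $\delta_{\overline F}$ to $\mathfrak{sl}(n,\overline F)$ is gauge equivalent over $\overline F$ to $\partial(\sqrt d\,r_{BD})$. Then: 1. $\Gamma_1=\Gamma_2=\emptyset$.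 2. $r_{BD}=r_s+r_{DJ}$ for some $r_s\in\mathfrak h_K\otimes\mathfrak h_K$ with $r_s+r_s^{21}=0$ and $\overline{r_s}=-r_s$. 3. There is $X\in\mathrm{GL}(n,K)$ with $\delta_{\overline F}=\partial\big(\sqrt d\,(\mathrm{Ad}_X\otimes\mathrm{Ad}_X)(r_{BD})\big)$, and for every such $X$ the matrix $X^*X$ is a diagonal matrix in $\mathrm{GL}(n,F)$. -/

import Mathlib

open scoped TensorProduct
open LieAlgebra.SpecialLinear

attribute [local instance 100] LieRing.ofAssociativeRing

noncomputable section

namespace SuBialgebra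

/-! ### Lie bialgebras -/

section General

variable {R : Type*} [CommRing R] {g : Type*} [LieRing g] [LieAlgebra R g]

/-- The transpose of a linear map `δ : g → g ⊗ g`, as an operation on the dual space:
`(f, f') ↦ (f ⊗ f') ∘ δ`. -/
def dualBracket (δ : g →ₗ[R] g ⊗[R] g) (f f' : Module.Dual R g) : Module.Dual R g :=
  LinearMap.mul' R R ∘ₗ TensorProduct.map f f' ∘ₗ δ

/-- `δ` is a Lie bialgebra structure on the Lie algebra `g`: its transpose is a Lie bracket on the
dual space, and `δ` satisfies the cocycle condition. The bracket `⁅a, t⁆` of `a : g` with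
`t : g ⊗ g` is the action `(ad a ⊗ 1 + 1 ⊗ ad a) t`. -/
structure IsLieBialgebra (δ : g →ₗ[R] g ⊗[R] g) : Prop where
  alternating : ∀ f, dualBracket δ f f = 0
  jacobi : ∀ f₁ f₂ f₃, dualBracket δ f₁ (dualBracket δ f₂ f₃)
    + dualBracket δ f₂ (dualBracket δ f₃ f₁) + dualBracket δ f₃ (dualBracket δ f₁ f₂) = 0
  cocycle : ∀ a b : g, δ ⁅a, b⁆ = ⁅a, δ b⁆ - ⁅b, δ a⁆

/-- The coboundary `∂r`, given by `(∂r)(a) = -(ad a ⊗ 1 + 1 ⊗ ad a) r`. -/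
def coboundary (r : g ⊗[R] g) : g →ₗ[R] g ⊗[R] g :=
  -((LieModule.toEnd R g (g ⊗[R] g) : g →ₗ[R] Module.End R (g ⊗[R] g)).flip r)

/-- The flip `a ⊗ b ↦ b ⊗ a`, `r ↦ r²¹`. -/
def flip : g ⊗[R] g →ₗ[R] g ⊗[R] g :=
  (TensorProduct.comm R g g).toLinearMap

/-- `a ∧ b = a ⊗ b - b ⊗ a`. -/
def wedge (a b : g) : g ⊗[R] g := a ⊗ₜ[R] b - b ⊗ₜ[R] a

end General

/-! ### The special linear Lie algebra and `r`-matrices -/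

section SpecialLinear

variable {n : ℕ} {R S : Type*} [Field R] [Field S]

/-- The adjoint action `A ↦ X A X⁻¹` of `GL(n, R)` on `sl(n, R)`. -/
def Ad (X : GL (Fin n) R) : sl (Fin n) R →ₗ[R] sl (Fin n) R where
  toFun A := ⟨X.1 * A.1 * (X⁻¹).1, by
    have hA : Matrix.trace A.1 = 0 := A.2
    change Matrix.trace (X.1 * A.1 * (X⁻¹).1) = 0
    rw [Matrix.trace_mul_cycle, Units.inv_mul, one_mul, hA]⟩
  map_add' A B := by ext : 1; simp [mul_add, add_mul]
  map_smul' c A := by ext : 1; simp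

/-- `Ad_X ⊗ Ad_X`. -/
def Ad₂ (X : GL (Fin n) R) : sl (Fin n) R ⊗[R] sl (Fin n) R →ₗ[R] sl (Fin n) R ⊗[R] sl (Fin n) R :=
  TensorProduct.map (Ad X) (Ad X)

/-- Two maps `D₁, D₂ : g → g ⊗ g`, `g = sl(n, R)`, are gauge equivalent over `R` if `D₂` is the
transport of `D₁` along the automorphism `Ad_X` of `g`, for some `X ∈ GL(n, R)`. -/
def GaugeEquivalent (D₁ D₂ : sl (Fin n) R →ₗ[R] sl (Fin n) R ⊗[R] sl (Fin n) R) : Prop :=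
  ∃ X : GL (Fin n) R, D₂ = Ad₂ X ∘ₗ D₁ ∘ₗ Ad X⁻¹

/-- The entrywise map `sl(n, R) → sl(n, S)` induced by a ring homomorphism `R → S`. -/
def slMap (φ : R →+* S) : sl (Fin n) R →ₛₗ[φ] sl (Fin n) S where
  toFun A := ⟨A.1.map φ, by
    have hA : Matrix.trace A.1 = 0 := A.2
    change Matrix.trace (A.1.map φ) = 0
    rw [← AddMonoidHom.map_trace, hA, map_zero]⟩
  map_add' A B := by ext; simp
  map_smul' c A := by ext; simp

/-- The map `sl(n, R) ⊗ sl(n, R) → sl(n, S) ⊗ sl(n, S)` induced by a ring homomorphism. -/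
def slMap₂ (φ : R →+* S) :
    sl (Fin n) R ⊗[R] sl (Fin n) R →ₛₗ[φ] sl (Fin n) S ⊗[S] sl (Fin n) S :=
  TensorProduct.map (slMap φ) (slMap φ)

variable (n R) in
/-- The Cartan subalgebra `h` of diagonal matrices in `sl(n, R)`. -/
def cartan : Submodule R (sl (Fin n) R) where
  carrier := {A | A.1.IsDiag}
  add_mem' hA hB := hA.add hB
  zero_mem' := Matrix.isDiag_zero
  smul_mem' c _ hA := hA.smul c

variable (n R) in
/-- The subspace `h ⊗ h` of `sl(n, R) ⊗ sl(n, R)`. -/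
def cartanTensor : Submodule R (sl (Fin n) R ⊗[R] sl (Fin n) R) :=
  LinearMap.range (TensorProduct.map (cartan n R).subtype (cartan n R).subtype)

/-- The `k`-th simple root `diag(a₁, …, aₙ) ↦ aₖ - aₖ₊₁`. -/
def simpleRoot (k : Fin (n - 1)) : sl (Fin n) R →ₗ[R] R where
  toFun A := A.1 ⟨k, by omega⟩ ⟨k, by omega⟩ - A.1 ⟨k + 1, by omega⟩ ⟨k + 1, by omega⟩
  map_add' A B := by simp; ring
  map_smul' c A := by simp; ring

variable (n R) in
/-- The Cartan part `Ω₀` of the Casimir element with respect to the trace form: it equals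
`∑ᵢ tᵢ ⊗ tᵢ = ∑ᵢ Eᵢᵢ ⊗ Eᵢᵢ - (1 / n) • (1 ⊗ 1)`, where
`tᵢ = Eᵢᵢ - (1 / n) • 1 = (1 / n) ∑ⱼ (Eᵢᵢ - Eⱼⱼ)` is the projection of `Eᵢᵢ` to `h`. -/
def casimirCartan : sl (Fin n) R ⊗[R] sl (Fin n) R :=
  let t : Fin n → sl (Fin n) R := fun i => (n : R)⁻¹ • ∑ j, singleSubSingle i j (1 : R)
  ∑ i, t i ⊗ₜ[R] t i

/-- A system of root vectors of `sl(n, R)`: for every root `α = εᵢ - εⱼ` a nonzero multiple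
`e i j` of the matrix unit `Eᵢⱼ`, such that `tr(e_α e_{-α}) = 1`. The values `e i i` play no
role. -/
def IsRootVectorSystem (e : Fin n → Fin n → sl (Fin n) R) : Prop :=
  ∀ i j, i ≠ j → (∃ c : R, (e i j).1 = Matrix.single i j c) ∧ Matrix.trace ((e i j).1 * (e j i).1) = 1

/-- `∑_{α > 0} e_α ⊗ e_{-α}`. -/
def positivePart (e : Fin n → Fin n → sl (Fin n) R) : sl (Fin n) R ⊗[R] sl (Fin n) R :=
  ∑ i, ∑ j, if i < j then e i j ⊗ₜ[R] e j i else 0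

variable (n R) in
/-- The Drinfeld--Jimbo `r`-matrix `r_DJ = Ω₀ / 2 + ∑_{i < j} Eᵢⱼ ⊗ Eⱼᵢ`. -/
def drinfeldJimbo : sl (Fin n) R ⊗[R] sl (Fin n) R :=
  (2 : R)⁻¹ • casimirCartan n R
    + positivePart fun i j => if h : i ≠ j then single i j h (1 : R) else 0

/-- The inclusion of `sl(n, R) ⊗ sl(n, R)` in the algebra `Mₙ(R) ⊗ Mₙ(R)`. -/
def toMatrixTensor : sl (Fin n) R ⊗[R] sl (Fin n) R →ₗ[R]
    Matrix (Fin n) (Fin n) R ⊗[R] Matrix (Fin n) (Fin n) R :=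
  TensorProduct.map (sl (Fin n) R).toSubmodule.subtype (sl (Fin n) R).toSubmodule.subtype

/-- The Yang--Baxter operator `CYB(r) = [r₁₂, r₁₃] + [r₁₂, r₂₃] + [r₁₃, r₂₃]`, with values in
`Mₙ(R) ⊗ Mₙ(R) ⊗ Mₙ(R)`. -/
def cyb (r : sl (Fin n) R ⊗[R] sl (Fin n) R) :
    Matrix (Fin n) (Fin n) R ⊗[R] (Matrix (Fin n) (Fin n) R ⊗[R] Matrix (Fin n) (Fin n) R) :=
  let M := Matrix (Fin n) (Fin n) R
  let r₁₂ := Algebra.TensorProduct.map (AlgHom.id R M)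
    (Algebra.TensorProduct.includeLeft : M →ₐ[R] M ⊗[R] M) (toMatrixTensor r)
  let r₁₃ := Algebra.TensorProduct.map (AlgHom.id R M)
    (Algebra.TensorProduct.includeRight : M →ₐ[R] M ⊗[R] M) (toMatrixTensor r)
  let r₂₃ := (Algebra.TensorProduct.includeRight : M ⊗[R] M →ₐ[R] M ⊗[R] (M ⊗[R] M))
    (toMatrixTensor r)
  (r₁₂ * r₁₃ - r₁₃ * r₁₂) + (r₁₂ * r₂₃ - r₂₃ * r₁₂) + (r₁₃ * r₂₃ - r₂₃ * r₁₃)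

/-! ### Belavin--Drinfeld `r`-matrices -/

variable (n) in
/-- An admissible triple `(Γ₁, Γ₂, τ)` for `sl(n)`. The simple roots are indexed by `Fin (n - 1)`;
only the values of `τ` on `Γ₁` matter. -/
structure AdmissibleTriple where
  Γ₁ : Set (Fin (n - 1))
  Γ₂ : Set (Fin (n - 1))
  τ : Fin (n - 1) → Fin (n - 1)
  bijOn : Set.BijOn τ Γ₁ Γ₂
  isometry : ∀ k ∈ Γ₁, ∀ l ∈ Γ₁,
    CartanMatrix.A (n - 1) (τ k) (τ l) = CartanMatrix.A (n - 1) k l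
  exits : ∀ k ∈ Γ₁, ∃ m : ℕ, τ^[m] k ∉ Γ₁

/-- The simple roots whose sum is the positive root `α = εᵢ - εⱼ`, where `α = (i, j)`, `i < j`. -/
def support (α : Fin n × Fin n) : Set (Fin (n - 1)) :=
  {k | (α.1 : ℕ) ≤ k ∧ (k : ℕ) < α.2}

/-- For positive roots `α`, `β`: there is `m ≥ 1` such that `α, τ(α), …, τ^{m-1}(α)` lie in the
span of `Γ₁` and `τ^m(α) = β`, where `τ` is extended additively. As `τ` has no periodic points,
`m` is then unique. -/
def AdmissibleTriple.Precedes (T : AdmissibleTriple n) (α β : Fin n × Fin n) : Prop :=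
  ∃ m : ℕ, 1 ≤ m ∧ (∀ l < m, T.τ^[l] '' support α ⊆ T.Γ₁) ∧ T.τ^[m] '' support α = support β

open Classical in
/-- `∑_{α ∈ Span(Γ₁)⁺} ∑_{m ≥ 1} e_α ∧ e_{-τ^m(α)}`, written as a sum over the pairs
`(α, β) = (α, τ^m(α))`. -/
def wedgePart (T : AdmissibleTriple n) (e : Fin n → Fin n → sl (Fin n) R) :
    sl (Fin n) R ⊗[R] sl (Fin n) R :=
  ∑ α : Fin n × Fin n, ∑ β : Fin n × Fin n,
    if α.1 < α.2 ∧ β.1 < β.2 ∧ T.Precedes α β then wedge (e α.1 α.2) (e β.2 β.1) else 0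

/-- `r` is a Belavin--Drinfeld `r`-matrix over `R` associated with the admissible triple `T`:
a solution of the classical Yang--Baxter equation of the form
`r = r₀ + ∑_{α > 0} e_α ⊗ e_{-α} + ∑_{α ∈ Span(Γ₁)⁺} ∑_{m ≥ 1} e_α ∧ e_{-τ^m(α)}`
with `r₀ ∈ h ⊗ h`, `r₀ + r₀²¹ = Ω₀` and `(τ(α) ⊗ 1 + 1 ⊗ α)(r₀) = 0` for all `α ∈ Γ₁`. -/
def IsBelavinDrinfeld (T : AdmissibleTriple n) (r : sl (Fin n) R ⊗[R] sl (Fin n) R) : Prop :=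
  cyb r = 0 ∧
  ∃ (r₀ : sl (Fin n) R ⊗[R] sl (Fin n) R) (e : Fin n → Fin n → sl (Fin n) R),
    IsRootVectorSystem e ∧
    r = r₀ + positivePart e + wedgePart T e ∧
    r₀ ∈ cartanTensor n R ∧
    r₀ + flip r₀ = casimirCartan n R ∧
    ∀ k ∈ T.Γ₁, TensorProduct.lid R _ (TensorProduct.map (simpleRoot (T.τ k)) LinearMap.id r₀)
      + TensorProduct.rid R _ (TensorProduct.map LinearMap.id (simpleRoot k) r₀) = 0

end SpecialLinear

/-! ### The special unitary Lie algebra -/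

section SpecialUnitary

variable {F K : Type*} [Field F] [Field K] [Algebra F K]

/-- The `F`-Lie algebra of all `A ∈ sl(n, K)` with `σ(A)ᵀ + A = 0`; for the nontrivial automorphism
`σ` of the quadratic extension `K = F(√d)` it is `su(n, F, d)`. -/
def su (n : ℕ) (σ : K ≃ₐ[F] K) : LieSubalgebra F (Matrix (Fin n) (Fin n) K) where
  carrier := {A | A ∈ sl (Fin n) K ∧ (A.map σ).transpose + A = 0}
  add_mem' := by
    rintro A B ⟨hA, hA'⟩ ⟨hB, hB'⟩
    refine ⟨add_mem hA hB, ?_⟩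
    rw [Matrix.map_add _ (map_add σ), Matrix.transpose_add, add_add_add_comm, hA', hB', add_zero]
  zero_mem' := ⟨zero_mem _, by ext; simp⟩
  smul_mem' := by
    rintro c A ⟨hA, hA'⟩
    refine ⟨?_, ?_⟩
    · rw [← algebraMap_smul K c A]
      exact (sl (Fin n) K).smul_mem _ hA
    · ext i j
      have := congrFun (congrFun hA' i) j
      simp only [Matrix.add_apply, Matrix.transpose_apply, Matrix.map_apply, Matrix.zero_apply,
        Matrix.smul_apply, map_smul] at this ⊢
      rw [← smul_add, this, smul_zero]
  lie_mem' := by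
    rintro A B ⟨hA, hA'⟩ ⟨hB, hB'⟩
    refine ⟨(sl (Fin n) K).lie_mem hA hB, ?_⟩
    have hA'' := eq_neg_of_add_eq_zero_left hA'
    have hB'' := eq_neg_of_add_eq_zero_left hB'
    rw [Ring.lie_def, Matrix.map_sub _ (map_sub σ), Matrix.map_mul, Matrix.map_mul,
      Matrix.transpose_sub, Matrix.transpose_mul, Matrix.transpose_mul, hA'', hB'']
    noncomm_ring

variable {n : ℕ} {σ : K ≃ₐ[F] K} (E : Type*) [Field E] [Algebra F E] [Algebra K E]
  [IsScalarTower F K E]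

/-- The canonical map `su(n, F, d) → sl(n, E)` for an extension field `E` of `K`. It induces the
isomorphism `E ⊗ su(n, F, d) ≃ sl(n, E)`. -/
def suIncl : su n σ →ₛₗ[algebraMap F E] sl (Fin n) E where
  toFun A := slMap (algebraMap K E) ⟨A.1, A.2.1⟩
  map_add' A B := by ext; simp [slMap]
  map_smul' c A := by
    ext i j
    simp [slMap, Algebra.smul_def, ← IsScalarTower.algebraMap_apply F K E]

variable {E} in
/-- `D` is the `E`-linear extension `δ_E` to `sl(n, E) = E ⊗ su(n, F, d)` of the map
`δ : su(n, F, d) → su(n, F, d) ⊗ su(n, F, d)`. It is determined by `δ`, because `su(n, F, d)` spans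
`sl(n, E)` over `E`. -/
def IsScalarExtension (δ : su n σ →ₗ[F] su n σ ⊗[F] su n σ)
    (D : sl (Fin n) E →ₗ[E] sl (Fin n) E ⊗[E] sl (Fin n) E) : Prop :=
  ∀ a : su n σ, D (suIncl E a) = TensorProduct.map (suIncl E) (suIncl E) (δ a)

end SpecialUnitary

end SuBialgebra

end

/-! Through the trace form, a tensor in sl(n) ⊗ sl(n) is an operator `f` on n × n matrices (`toOp`).
The flip becomes the adjoint `f'`, `Ad₂ X` becomes conjugation by `X`, and r + r²¹ = Casimir becomes
f + f' = 1 − (projection to the scalars).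

That δ is defined over su(n, F, d) is expressed by invariance under semilinear Lie automorphisms θ
of gl(n, L) fixing su: x ↦ γ(x) for γ trivial on K, and x ↦ −γ(x)ᵀ for γ extending σ. Transporting
the operator of √d·r by θ does not change its commutators with ad(su). After correcting the
symmetric part, the difference is an ad-invariant skew operator killing 1, hence zero
(`coboundary_commute`, `eq_zero_of_commute_of_skew`). Take r = Ad_X(r_BD) and let f be the operator
of r_BD. The first kind of θ shows that f commutes with γ followed by conjugation by X⁻¹γ(X). The
second, because σ(√d) = −√d, gives f'(u γ(x)ᵀ v) = u γ(f x)ᵀ v, where v = γ(X)ᵀX and u = v⁻¹.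

The operator f is nilpotent on strictly lower and unipotent on strictly upper triangular matrices,
since every term from the wedge part moves strictly along the order α ≺ τ^m(α); f' has these roles
exchanged. Comparing generalized eigenspaces, conjugation by u sends strictly upper matrices to
matrices without lower entries, and conversely, which forces u to be diagonal
(`isDiag_of_conj_triangular`). The intertwining relation then matches the coefficient of e_α ∧
e_{−β} with that of e_β ∧ e_{−α}. So the strict order ≺ is symmetric, hence empty, and Γ₁ = ∅.

On diagonal matrices the relation reads γ(r₀) = Ω₀ − r₀ for every γ extending σ. Composing with
Gal(L/K) shows that r₀ is defined over K, and r₀ − Ω₀/2 is the required r_s. Now f commutes with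
Gal(L/K), so X⁻¹γ(X) commutes with f and is diagonal; rescaling the columns of X moves it into GL(n,
K) without changing Ad_X(r_BD). For X over K, v = X*X is diagonal, and its entries are fixed by σ,
so they lie in F. -/

namespace SuBialgebra

/-! ### Tensors as operators -/

section Operators

variable {n : ℕ} {R S : Type*} [Field R] [Field S]

/-- The functional `x ↦ tr(b x)` on matrices defined by `b ∈ sl(n, R)`. -/
def traceFunctional : sl (Fin n) R →ₗ[R] Module.Dual R (Matrix (Fin n) (Fin n) R) where
  toFun b := Matrix.traceLinearMap (Fin n) R R ∘ₗ LinearMap.mulLeft R b.1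
  map_add' a b := by ext; simp [add_mul]
  map_smul' c b := by ext; simp

/-- The operator on matrices attached to a tensor through the trace form:
`a ⊗ b ↦ (x ↦ tr(b x) a)`. -/
def toOp : sl (Fin n) R ⊗[R] sl (Fin n) R →ₗ[R] Module.End R (Matrix (Fin n) (Fin n) R) :=
  dualTensorHom R _ _ ∘ₗ
    TensorProduct.map traceFunctional (sl (Fin n) R).toSubmodule.subtype ∘ₗ
      (TensorProduct.comm R (sl (Fin n) R) (sl (Fin n) R)).toLinearMap

@[simp]
theorem toOp_tmul (a b : sl (Fin n) R) (x : Matrix (Fin n) (Fin n) R) :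
    toOp (a ⊗ₜ b) x = (b.1 * x).trace • a.1 := by
  simp [toOp, traceFunctional]

theorem eq_of_forall_trace_mul {a b : Matrix (Fin n) (Fin n) R}
    (h : ∀ x, (a * x).trace = (b * x).trace) : a = b := by
  ext i j
  simpa [Matrix.trace_mul_single] using h (Matrix.single j i 1)

/-- Nondegeneracy of the trace form on all matrices. It lets identities of tensors be checked on
operators. -/
theorem toOp_injective :
    Function.Injective (toOp : sl (Fin n) R ⊗[R] sl (Fin n) R →ₗ[R] _) := by
  have h₁ : Function.Injective (traceFunctional : sl (Fin n) R →ₗ[R] _) := fun a b h =>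
    Subtype.ext (eq_of_forall_trace_mul fun x => LinearMap.congr_fun h x)
  have h₂ : Function.Injective (sl (Fin n) R).toSubmodule.subtype := Subtype.val_injective
  simp only [toOp, LinearMap.coe_comp]
  refine dualTensorHom_bijective.injective.comp (Function.Injective.comp ?_ (TensorProduct.comm R _ _).injective)
  exact TensorProduct.map_injective_of_flat_flat _ _ h₁ h₂

theorem toOp_lie (a : sl (Fin n) R) (r : sl (Fin n) R ⊗[R] sl (Fin n) R)
    (x : Matrix (Fin n) (Fin n) R) :
    toOp ⁅a, r⁆ x = ⁅a.1, toOp r x⁆ - toOp r ⁅a.1, x⁆ := by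
  induction r using TensorProduct.induction_on with
  | zero => simp
  | add r s hr hs =>
    simp only [lie_add, map_add, LinearMap.add_apply, hr, hs]
    abel
  | tmul b c =>
    have h : ((⁅a, c⁆ : sl (Fin n) R).1 * x).trace = -(c.1 * ⁅a.1, x⁆).trace := by
      simp only [sl_bracket, Ring.lie_def, sub_mul, mul_sub, Matrix.trace_sub]
      rw [mul_assoc a.1, Matrix.trace_mul_comm a.1]
      simp only [mul_assoc, neg_sub]
    simp only [TensorProduct.LieModule.lie_tmul_right, map_add, LinearMap.add_apply, toOp_tmul, h]
    simp only [sl_bracket, Ring.lie_def, Matrix.mul_smul, Matrix.smul_mul, smul_sub]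
    module

theorem toOp_Ad₂ (X : GL (Fin n) R) (r : sl (Fin n) R ⊗[R] sl (Fin n) R)
    (x : Matrix (Fin n) (Fin n) R) :
    toOp (Ad₂ X r) x = X.1 * toOp r (X⁻¹.1 * x * X.1) * X⁻¹.1 := by
  induction r using TensorProduct.induction_on with
  | zero => simp
  | add r s hr hs => simp only [map_add, LinearMap.add_apply, hr, hs, mul_add, add_mul]
  | tmul b c =>
    have h : (X.1 * c.1 * X⁻¹.1 * x).trace = (c.1 * (X⁻¹.1 * x * X.1)).trace := by
      rw [mul_assoc, mul_assoc, Matrix.trace_mul_comm]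
      simp only [mul_assoc]
    simp only [Ad₂, TensorProduct.map_tmul, toOp_tmul, Ad, LinearMap.coe_mk, AddHom.coe_mk, h,
      Matrix.mul_smul, Matrix.smul_mul]

/-- The flip is the adjoint for the trace form. -/
theorem trace_toOp_flip (r : sl (Fin n) R ⊗[R] sl (Fin n) R) (x y : Matrix (Fin n) (Fin n) R) :
    (toOp (flip r) x * y).trace = (x * toOp r y).trace := by
  induction r using TensorProduct.induction_on with
  | zero => simp
  | add r s hr hs =>
    simp only [map_add, LinearMap.add_apply, add_mul, mul_add, Matrix.trace_add, hr, hs]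
  | tmul b c =>
    simp only [flip, LinearEquiv.coe_coe, TensorProduct.comm_tmul, toOp_tmul, Matrix.smul_mul,
      Matrix.mul_smul, Matrix.trace_smul, smul_eq_mul]
    rw [mul_comm, Matrix.trace_mul_comm b.1]

theorem flip_Ad₂ (X : GL (Fin n) R) (r : sl (Fin n) R ⊗[R] sl (Fin n) R) :
    flip (Ad₂ X r) = Ad₂ X (flip r) := by
  induction r using TensorProduct.induction_on with
  | zero => simp
  | add r s hr hs => simp only [map_add, hr, hs]
  | tmul b c => simp [Ad₂, flip]

theorem flip_flip (r : sl (Fin n) R ⊗[R] sl (Fin n) R) : flip (flip r) = r := by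
  simp [flip]

theorem Ad₂_lie (X : GL (Fin n) R) (a : sl (Fin n) R) (r : sl (Fin n) R ⊗[R] sl (Fin n) R) :
    Ad₂ X ⁅a, r⁆ = ⁅Ad X a, Ad₂ X r⁆ := by
  have h (b : sl (Fin n) R) : Ad X ⁅a, b⁆ = ⁅Ad X a, Ad X b⁆ := by
    apply Subtype.ext
    simp only [Ad, LinearMap.coe_mk, AddHom.coe_mk, sl_bracket, mul_sub, sub_mul]
    congr 1 <;> simp only [mul_assoc, Units.inv_mul_cancel_left]
  induction r using TensorProduct.induction_on with
  | zero => simp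
  | add r s hr hs => simp only [map_add, lie_add, hr, hs]
  | tmul b c =>
    simp only [Ad₂, TensorProduct.LieModule.lie_tmul_right, map_add, TensorProduct.map_tmul, h]

theorem coboundary_apply {R g : Type*} [CommRing R] [LieRing g] [LieAlgebra R g] (r : g ⊗[R] g)
    (a : g) : coboundary r a = -⁅a, r⁆ := rfl

/-- By equivariance of the bracket, gauge transformations of coboundaries act on the `r`-matrix
alone. -/
theorem Ad₂_comp_coboundary (X : GL (Fin n) R) (r : sl (Fin n) R ⊗[R] sl (Fin n) R) :
    Ad₂ X ∘ₗ coboundary r ∘ₗ Ad X⁻¹ = coboundary (Ad₂ X r) := by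
  ext1 a
  have h : Ad X (Ad X⁻¹ a) = a := by
    apply Subtype.ext
    simp [Ad, mul_assoc]
  simp only [LinearMap.comp_apply, coboundary_apply, map_neg, Ad₂_lie, h]

@[simp]
theorem slMap_coe (φ : R →+* S) (a : sl (Fin n) R) : (slMap φ a).1 = a.1.map φ := rfl

end Operators

/-! ### Operators commuting with the adjoint action -/

section Invariants

variable {n : ℕ} {R : Type*} [Field R]

theorem lie_single_single (i j : Fin n) :
    ⁅Matrix.single i j (1 : R), Matrix.single j i (1 : R)⁆
      = Matrix.single i i 1 - Matrix.single j j 1 := by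
  simp [Ring.lie_def]

variable [CharZero R]

theorem submodule_matrix_eq_top (N : Submodule R (Matrix (Fin n) (Fin n) R)) (h₁ : 1 ∈ N)
    (h₂ : ∀ i j, i ≠ j → Matrix.single i j 1 ∈ N)
    (h₃ : ∀ i j, i ≠ j → Matrix.single i i 1 - Matrix.single j j 1 ∈ N) : N = ⊤ := by
  have hd (i : Fin n) : Matrix.single i i 1 ∈ N := by
    have hn : (n : R) ≠ 0 := Nat.cast_ne_zero.mpr (Fin.pos i).ne'
    have hs : (n : R) • Matrix.single i i (1 : R)
        = 1 + ∑ j, (Matrix.single i i (1 : R) - Matrix.single j j 1) := by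
      rw [Finset.sum_sub_distrib, Matrix.sum_single_one]
      simp [Nat.cast_smul_eq_nsmul]
    -- Characteristic 0 enters here: n·Eᵢᵢ = 1 + ∑ⱼ (Eᵢᵢ − Eⱼⱼ), and n must be inverted.
    have hm : (n : R) • Matrix.single i i (1 : R) ∈ N := by
      rw [hs]
      refine N.add_mem h₁ (N.sum_mem fun j _ => ?_)
      by_cases hij : i = j
      · simp [hij]
      · exact h₃ i j hij
    simpa [smul_smul, hn] using N.smul_mem (n : R)⁻¹ hm
  rw [eq_top_iff]
  intro x _
  rw [Matrix.matrix_eq_sum_single x]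
  refine N.sum_mem fun i _ => N.sum_mem fun j _ => ?_
  have hx : Matrix.single i j (x i j) = x i j • Matrix.single i j (1 : R) := by simp
  rw [hx]
  refine N.smul_mem _ ?_
  by_cases hij : i = j
  · exact hij ▸ hd i
  · exact h₂ i j hij

/-- A linear operator on matrices which commutes with `ad (sl(n))`, is skew for the trace form and
kills `1` vanishes. -/
theorem eq_zero_of_commute_of_skew (t : Module.End R (Matrix (Fin n) (Fin n) R))
    (hcomm : ∀ i j : Fin n, i ≠ j → ∀ x, t ⁅Matrix.single i j (1 : R), x⁆ = ⁅Matrix.single i j (1 : R), t x⁆)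
    (hskew : ∀ x y, (t x * y).trace = -(x * t y).trace) (hone : t 1 = 0) : t = 0 := by
  let C : Submodule R (Matrix (Fin n) (Fin n) R) :=
    { carrier := {z | ∀ x, t ⁅z, x⁆ = ⁅z, t x⁆}
      add_mem' := fun ha hb x => by simp only [add_lie, map_add, ha x, hb x]
      zero_mem' := fun x => by simp
      smul_mem' := fun c z hz x => by simp only [smul_lie, map_smul, hz x] }
  have hC : C = ⊤ := by
    refine submodule_matrix_eq_top C ?_ hcomm ?_
    · intro x
      simp [Ring.lie_def]
    · intro i j hij x
      rw [← lie_single_single i j, lie_lie, lie_lie, map_sub, hcomm i j hij, hcomm j i hij.symm,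
        hcomm j i hij.symm, hcomm i j hij]
  have hl (z x : Matrix (Fin n) (Fin n) R) : t ⁅z, x⁆ = ⁅z, t x⁆ := (hC ▸ Submodule.mem_top : z ∈ C) x
  -- Antisymmetry of the bracket moves `t` to the other factor. With skewness, carrying `t` once
  -- around tr([x, y] z) changes its sign, so `t` kills commutators; no Schur lemma is needed.
  have hr (z x : Matrix (Fin n) (Fin n) R) : t ⁅z, x⁆ = ⁅t z, x⁆ := by
    rw [← lie_skew, map_neg, hl, lie_skew]
  have htr (x y z : Matrix (Fin n) (Fin n) R) : (⁅x, y⁆ * z).trace = (x * ⁅y, z⁆).trace := by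
    simp only [Ring.lie_def, sub_mul, mul_sub, Matrix.trace_sub, mul_assoc]
    rw [Matrix.trace_mul_comm y]
    simp only [mul_assoc]
  have hlie (x y : Matrix (Fin n) (Fin n) R) : t ⁅x, y⁆ = 0 := by
    refine eq_of_forall_trace_mul fun z => ?_
    have h : (t ⁅x, y⁆ * z).trace = -(t ⁅x, y⁆ * z).trace := by
      calc (t ⁅x, y⁆ * z).trace = (t x * ⁅y, z⁆).trace := by rw [hr, htr]
        _ = -(x * ⁅t y, z⁆).trace := by rw [hskew, hr]
        _ = -(t ⁅x, y⁆ * z).trace := by rw [hl, htr]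
    simpa using self_eq_neg.mp h
  have hker : LinearMap.ker t = ⊤ := by
    refine submodule_matrix_eq_top _ hone ?_ ?_
    · intro i j hij
      have h : Matrix.single i j (1 : R) = ⁅Matrix.single i i (1 : R), Matrix.single i j (1 : R)⁆ := by
        simp [Ring.lie_def, hij.symm]
      rw [LinearMap.mem_ker, h, hlie]
    · intro i j hij
      rw [LinearMap.mem_ker, ← lie_single_single i j, hlie]
  exact LinearMap.ker_eq_top.mp hker

end Invariants

/-! ### Triangularity -/

section Triangular

variable {n : ℕ} {R : Type*} [Field R]

/-- If `Ψ` intertwines `s`, which is nilpotent on the span of the matrix units in `A`, with `s'`,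
which acts unipotently on the coordinates in `B`, then the coordinates in `B` of `Ψ` vanish on the
matrix units in `A`. -/
theorem apply_single_eq_zero_of_intertwine {A B : Fin n → Fin n → Prop}
    {r r' : Fin n × Fin n → Fin n × Fin n → Prop} (hr : WellFounded r) (hr' : WellFounded r')
    {s s' : Module.End R (Matrix (Fin n) (Fin n) R)}
    (Ψ : Matrix (Fin n) (Fin n) R → Matrix (Fin n) (Fin n) R) (hΨ : Ψ 0 = 0)
    (hs : ∀ i j, A i j → ∀ N : Submodule R (Matrix (Fin n) (Fin n) R),
      (∀ k l, A k l → r (k, l) (i, j) → Matrix.single k l 1 ∈ N) → s (Matrix.single i j 1) ∈ N)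
    (hs' : ∀ i j, B i j → ∀ x : Matrix (Fin n) (Fin n) R,
      (∀ k l, B k l → r' (k, l) (i, j) → x k l = 0) → s' x i j = x i j)
    (h : ∀ x, s' (Ψ x) = Ψ (s x)) {i j k l : Fin n} (hij : A i j) (hkl : B k l) :
    Ψ (Matrix.single i j 1) k l = 0 := by
  -- `s` lowers the matrix units in `A` along a well-founded relation, so each of them lies in the
  -- generalized 0-eigenspace.
  have hmem (p : Fin n × Fin n) :
      A p.1 p.2 → Matrix.single p.1 p.2 1 ∈ Module.End.maxGenEigenspace s 0 := by
    induction p using hr.induction with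
    | _ p ih =>
      intro hp
      obtain ⟨m, hm⟩ := (Module.End.mem_maxGenEigenspace s 0 _).mp
        (hs p.1 p.2 hp (Module.End.maxGenEigenspace s 0) fun k l hkl hr => ih (k, l) hr hkl)
      refine (Module.End.mem_maxGenEigenspace s 0 _).mpr ⟨m + 1, ?_⟩
      rw [zero_smul, sub_zero] at hm ⊢
      rw [pow_succ, Module.End.mul_apply, hm]
  -- A vector killed by a power of `s'` has no coordinates in `B`: once the `r'`-smaller coordinates
  -- vanish, `s'` leaves the coordinate at `q` unchanged, while its power makes it 0.
  have hvan (q : Fin n × Fin n) :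
      B q.1 q.2 → ∀ x, (∃ m : ℕ, (s' ^ m) x = 0) → x q.1 q.2 = 0 := by
    induction q using hr'.induction with
    | _ q ih =>
      rintro hq x ⟨m, hm⟩
      have hstep (t : ℕ) : (s' ^ t) x q.1 q.2 = x q.1 q.2 := by
        induction t with
        | zero => simp
        | succ t iht =>
          rw [pow_succ', Module.End.mul_apply, hs' q.1 q.2 hq, iht]
          intro k l hkl hr
          refine ih (k, l) hr hkl _ ⟨m, ?_⟩
          rw [← Module.End.mul_apply, ← pow_add, add_comm, pow_add, Module.End.mul_apply, hm,
            map_zero]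
      rw [← hstep m, hm, Matrix.zero_apply]
  obtain ⟨m, hm⟩ := (Module.End.mem_maxGenEigenspace s 0 _).mp (hmem (i, j) hij)
  rw [zero_smul, sub_zero] at hm
  refine hvan (k, l) hkl _ ⟨m, ?_⟩
  have hpow (t : ℕ) (x) : (s' ^ t) (Ψ x) = Ψ ((s ^ t) x) := by
    induction t generalizing x with
    | zero => simp
    | succ t iht => rw [pow_succ, pow_succ, Module.End.mul_apply, Module.End.mul_apply, h, iht]
  rw [hpow, hm, hΨ]

theorem mul_single_mul_apply (u v : Matrix (Fin n) (Fin n) R) (i j k l : Fin n) :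
    (u * Matrix.single i j (1 : R) * v : Matrix (Fin n) (Fin n) R) k l = u k i * v j l := by
  rw [Matrix.mul_apply, Finset.sum_eq_single j]
  · simp
  · intro b _ hb
    rw [Matrix.mul_single_apply_of_ne _ _ _ _ _ hb, zero_mul]
  · simp

/-- If conjugation by `u` preserves both the upper and the lower triangular nilpotent matrices, then
`u` is diagonal. -/
theorem isDiag_of_conj_triangular {u v : Matrix (Fin n) (Fin n) R} (huv : u * v = 1)
    (h₁ : ∀ i j k l, i < j → k < l → u l i * v j k = 0)
    (h₂ : ∀ i j k l, j < i → l < k → u l i * v j k = 0) :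
    u.IsDiag ∧ v.IsDiag := by
  have hvu : v * u = 1 := mul_eq_one_comm.mp huv
  have hvu' (i j : Fin n) (hij : i ≠ j) : ∑ m, v i m * u m j = 0 := by
    rw [← Matrix.mul_apply, hvu, Matrix.one_apply_ne hij]
  have hdiag (i j k : Fin n) (hij : i ≠ j) : u k i * v j k = 0 := by
    have h := hvu' j i hij.symm
    -- Expand the off-diagonal entry (v u)ⱼᵢ = 0. For m ≠ k, the product (u k i · v j m)(u m i · v j
    -- k) has a factor at a position (k, m) or (m, k) covered by `h₁` or `h₂`, so only the square
    -- survives.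
    have hsq : (u k i * v j k) * (u k i * v j k) = 0 := by
      calc (u k i * v j k) * (u k i * v j k) = u k i * (v j k * u k i) * v j k := by ring
        _ = u k i * (∑ m, v j m * u m i) * v j k := by
          rw [Finset.mul_sum, Finset.sum_mul, Finset.sum_eq_single k, ← mul_assoc]
          · intro m _ hm
            rcases lt_or_gt_of_ne hij with hij | hij <;> rcases lt_or_gt_of_ne hm with hm | hm
            · linear_combination (u m i * v j k) * h₁ i j m k hij hm
            · linear_combination (u k i * v j m) * h₁ i j k m hij hm
            · linear_combination (u k i * v j m) * h₂ i j k m hij hm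
            · linear_combination (u m i * v j k) * h₂ i j m k hij hm
          · simp
        _ = 0 := by rw [h]; ring
    exact mul_self_eq_zero.mp hsq
  -- Since (u v)ₖₖ = 1, row k of `u` and column k of `v` meet in a nonzero term, unique by `hdiag`.
  -- So `u` is monomial, and `h₁` makes its permutation monotone, hence the identity.
  have hex (k : Fin n) : ∃ i, u k i * v i k ≠ 0 := by
    by_contra! hk
    have h : (u * v) k k = 0 := by
      rw [Matrix.mul_apply]
      exact Finset.sum_eq_zero fun i _ => hk i
    simp [huv] at h
  choose π hπ using hex
  have hu (k) : u k (π k) ≠ 0 := left_ne_zero_of_mul (hπ k)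
  have hv (k) : v (π k) k ≠ 0 := right_ne_zero_of_mul (hπ k)
  have hv0 (i k) (h : i ≠ π k) : v i k = 0 :=
    (mul_eq_zero.mp (hdiag (π k) i k h.symm)).resolve_left (hu k)
  have hu0 (i k) (h : i ≠ π k) : u k i = 0 :=
    (mul_eq_zero.mp (hdiag i (π k) k h)).resolve_right (hv k)
  have hmono : StrictMono π := by
    intro k l hkl
    refine lt_of_le_of_ne ?_ ?_
    · by_contra! hlt
      exact mul_ne_zero (hu l) (hv k) (h₁ _ _ _ _ hlt hkl)
    · intro heq
      have h : (u * v) l k = u l (π k) * v (π k) k := by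
        rw [Matrix.mul_apply, Finset.sum_eq_single (π k)]
        · intro b _ hb
          rw [hv0 b k hb, mul_zero]
        · simp
      rw [huv, Matrix.one_apply_ne hkl.ne', heq] at h
      exact mul_ne_zero (hu l) (heq ▸ hv k) h.symm
  have hid : π = id := by
    refine (hmono.range_inj strictMono_id).mp ?_
    rw [Set.range_id, (Finite.injective_iff_surjective.mp hmono.injective).range_eq]
  subst hid
  exact ⟨fun i j hij => hu0 j i (Ne.symm hij), fun i j hij => hv0 i j hij⟩

end Triangular

/-! ### The Cartan part -/

section Cartan

variable {n : ℕ} {R S : Type*} [Field R] [Field S]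

variable (R) in
/-- The projection of `Eᵢᵢ` to the Cartan subalgebra. -/
def cartanProj (i : Fin n) : sl (Fin n) R := (n : R)⁻¹ • ∑ j, singleSubSingle i j (1 : R)

theorem casimirCartan_eq :
    casimirCartan n R = ∑ i, cartanProj R i ⊗ₜ[R] cartanProj R i := rfl

/-- The coefficients of a tensor in `h ⊗ h` with respect to the tensors of the `cartanProj`. -/
def cartanCoeff (r : sl (Fin n) R ⊗[R] sl (Fin n) R) (i j : Fin n) : R :=
  toOp r (Matrix.single j j 1) i i

theorem cartanCoeff_tmul (a b : sl (Fin n) R) (i j : Fin n) :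
    cartanCoeff (a ⊗ₜ b) i j = a.1 i i * b.1 j j := by
  simp [cartanCoeff, Matrix.trace_mul_single, mul_comm]

theorem cartanCoeff_add (r s : sl (Fin n) R ⊗[R] sl (Fin n) R) (i j : Fin n) :
    cartanCoeff (r + s) i j = cartanCoeff r i j + cartanCoeff s i j := by
  simp [cartanCoeff]

theorem cartanCoeff_flip (r : sl (Fin n) R ⊗[R] sl (Fin n) R) (i j : Fin n) :
    cartanCoeff (flip r) i j = cartanCoeff r j i := by
  have h := trace_toOp_flip r (Matrix.single j j 1) (Matrix.single i i 1)
  simpa [cartanCoeff, Matrix.trace_mul_single, Matrix.trace_single_mul] using h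

@[elab_as_elim]
theorem cartanTensor_induction {p : sl (Fin n) R ⊗[R] sl (Fin n) R → Prop}
    (tmul : ∀ a b, a.1.IsDiag → b.1.IsDiag → p (a ⊗ₜ b)) (zero : p 0)
    (add : ∀ r s, p r → p s → p (r + s)) {r : sl (Fin n) R ⊗[R] sl (Fin n) R}
    (hr : r ∈ cartanTensor n R) : p r := by
  obtain ⟨s, rfl⟩ := hr
  induction s using TensorProduct.induction_on with
  | zero => simpa using zero
  | add r s hr hs =>
    rw [map_add]
    exact add _ _ hr hs
  | tmul a b => exact tmul _ _ a.2 b.2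

theorem toOp_of_mem_cartanTensor {r : sl (Fin n) R ⊗[R] sl (Fin n) R} (hr : r ∈ cartanTensor n R)
    (x : Matrix (Fin n) (Fin n) R) (i j : Fin n) :
    toOp r x i j = if i = j then ∑ k, cartanCoeff r i k * x k k else 0 := by
  refine cartanTensor_induction ?_ ?_ ?_ hr
  · intro a b ha hb
    have htr : (b.1 * x).trace = ∑ k, b.1 k k * x k k := by
      rw [Matrix.trace]
      refine Finset.sum_congr rfl fun k _ => ?_
      rw [Matrix.diag_apply, Matrix.mul_apply, Finset.sum_eq_single k]
      · intro l _ hl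
        rw [hb hl.symm, zero_mul]
      · simp
    simp only [toOp_tmul, htr, Matrix.smul_apply, smul_eq_mul, cartanCoeff_tmul]
    split_ifs with hij
    · subst hij
      rw [Finset.sum_mul]
      exact Finset.sum_congr rfl fun k _ => by ring
    · rw [ha hij, mul_zero]
  · simp [cartanCoeff]
  · intro r s hr hs
    rw [map_add, LinearMap.add_apply, Matrix.add_apply, hr, hs]
    split_ifs
    · rw [← Finset.sum_add_distrib]
      exact Finset.sum_congr rfl fun k _ => by simp [cartanCoeff, add_mul]
    · simp

theorem flip_sum_cartanProj (c : Fin n → Fin n → R) :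
    flip (∑ i, ∑ j, c i j • (cartanProj R i ⊗ₜ[R] cartanProj R j))
      = ∑ i, ∑ j, c j i • (cartanProj R i ⊗ₜ[R] cartanProj R j) := by
  simp only [map_sum, map_smul, flip, LinearEquiv.coe_coe, TensorProduct.comm_tmul]
  exact Finset.sum_comm

variable [CharZero R] [CharZero S]

theorem cartanProj_coe (i : Fin n) :
    (cartanProj R i).1 = Matrix.single i i 1 - (n : R)⁻¹ • (1 : Matrix (Fin n) (Fin n) R) := by
  have hn : (n : R) ≠ 0 := Nat.cast_ne_zero.mpr (Fin.pos i).ne'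
  have h : (cartanProj R i).1
      = (n : R)⁻¹ • ∑ j, (Matrix.single i i (1 : R) - Matrix.single j j 1) := by
    simp [cartanProj]
  rw [h, Finset.sum_sub_distrib, Matrix.sum_single_one, smul_sub, Finset.sum_const,
    Finset.card_univ, Fintype.card_fin, ← Nat.cast_smul_eq_nsmul R, smul_smul, inv_mul_cancel₀ hn,
    one_smul]

theorem cartanProj_mem (i : Fin n) : cartanProj R i ∈ cartan n R := by
  intro j k hjk
  rw [cartanProj_coe]
  simp [Matrix.single_apply, Matrix.one_apply_ne hjk]
  rintro rfl h
  exact hjk h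

theorem slMap_cartanProj (φ : R →+* S) (i : Fin n) : slMap φ (cartanProj R i) = cartanProj S i := by
  apply Subtype.ext
  rw [slMap_coe, cartanProj_coe, cartanProj_coe]
  ext j k
  by_cases hjk : j = k <;> simp [Matrix.single_apply, hjk, apply_ite φ]

theorem toOp_casimirCartan (x : Matrix (Fin n) (Fin n) R) (i j : Fin n) :
    toOp (casimirCartan n R) x i j = if i = j then x i i - (n : R)⁻¹ * x.trace else 0 := by
  have hn : (n : R) ≠ 0 := Nat.cast_ne_zero.mpr (Fin.pos i).ne'
  have h (k : Fin n) : ((cartanProj R k).1 * x).trace = x k k - (n : R)⁻¹ * x.trace := by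
    simp [cartanProj_coe, sub_mul, Matrix.trace_single_mul]
  have h0 : ∑ k, (x k k - (n : R)⁻¹ * x.trace) = 0 := by
    rw [Finset.sum_sub_distrib]
    simp [Matrix.trace, hn]
  rw [casimirCartan_eq, map_sum, LinearMap.sum_apply, Matrix.sum_apply]
  simp only [toOp_tmul, h]
  simp only [cartanProj_coe, Matrix.smul_apply, Matrix.sub_apply, smul_eq_mul, mul_sub]
  rw [Finset.sum_sub_distrib, ← Finset.sum_mul, h0, zero_mul, sub_zero]
  split_ifs with hij
  · subst hij
    simp [Matrix.single_apply]
  · refine Finset.sum_eq_zero fun k _ => ?_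
    rw [Matrix.single_apply_of_ne, mul_zero]
    rintro ⟨rfl, h⟩
    exact hij h

theorem cartanCoeff_casimirCartan (i j : Fin n) :
    cartanCoeff (casimirCartan n R) i j = (if i = j then 1 else 0) - (n : R)⁻¹ := by
  rw [cartanCoeff, toOp_casimirCartan, if_pos rfl, Matrix.trace_single_eq_same, mul_one,
    Matrix.single_apply]
  simp [eq_comm]

theorem map_cartanCoeff_casimirCartan (φ : R →+* S) (i j : Fin n) :
    φ (cartanCoeff (casimirCartan n R) i j) = cartanCoeff (casimirCartan n S) i j := by
  rw [cartanCoeff_casimirCartan, cartanCoeff_casimirCartan]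
  simp [apply_ite φ]

theorem eq_sum_cartanProj {a : sl (Fin n) R} (ha : a.1.IsDiag) :
    a = ∑ i, a.1 i i • cartanProj R i := by
  have htr : ∑ i, a.1 i i = 0 := a.2
  apply Subtype.ext
  have h : (∑ i, a.1 i i • cartanProj R i).1 = ∑ i, a.1 i i • (cartanProj R i).1 := by simp
  rw [h]
  ext j k
  rw [Matrix.sum_apply]
  simp only [cartanProj_coe, Matrix.smul_apply, Matrix.sub_apply, smul_eq_mul, mul_sub]
  rw [Finset.sum_sub_distrib, ← Finset.sum_mul, htr, zero_mul, sub_zero]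
  by_cases hjk : j = k
  · subst hjk
    simp [Matrix.single_apply]
  · rw [ha hjk, eq_comm]
    refine Finset.sum_eq_zero fun l _ => ?_
    rw [Matrix.single_apply_of_ne, mul_zero]
    rintro ⟨rfl, h⟩
    exact hjk h

/-- The `cartanProj` sum to zero, so coefficients are not unique. Reading off diagonal entries works
because the traces vanish, and this choice commutes with field automorphisms. -/
theorem eq_sum_cartanCoeff {r : sl (Fin n) R ⊗[R] sl (Fin n) R} (hr : r ∈ cartanTensor n R) :
    r = ∑ i, ∑ j, cartanCoeff r i j • (cartanProj R i ⊗ₜ[R] cartanProj R j) := by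
  refine cartanTensor_induction ?_ ?_ ?_ hr
  · intro a b ha hb
    conv_lhs => rw [eq_sum_cartanProj ha, eq_sum_cartanProj hb]
    simp_rw [TensorProduct.sum_tmul, TensorProduct.tmul_sum, TensorProduct.smul_tmul_smul,
      cartanCoeff_tmul]
  · simp [cartanCoeff]
  · intro r s hr hs
    simp only [cartanCoeff_add, add_smul, Finset.sum_add_distrib]
    rw [← hr, ← hs]

theorem sum_cartanProj_mem (c : Fin n → Fin n → R) :
    ∑ i, ∑ j, c i j • (cartanProj R i ⊗ₜ[R] cartanProj R j) ∈ cartanTensor n R :=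
  Submodule.sum_mem _ fun i _ => Submodule.sum_mem _ fun j _ => Submodule.smul_mem _ _
    ⟨⟨_, cartanProj_mem i⟩ ⊗ₜ ⟨_, cartanProj_mem j⟩, rfl⟩

theorem slMap₂_sum_cartanProj (φ : R →+* S) (c : Fin n → Fin n → R) :
    slMap₂ φ (∑ i, ∑ j, c i j • (cartanProj R i ⊗ₜ[R] cartanProj R j))
      = ∑ i, ∑ j, φ (c i j) • (cartanProj S i ⊗ₜ[S] cartanProj S j) := by
  simp only [map_sum, map_smulₛₗ, slMap₂, TensorProduct.map_tmul, slMap_cartanProj]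

theorem casimirCartan_mem : casimirCartan n R ∈ cartanTensor n R :=
  Submodule.sum_mem _ fun i _ => ⟨⟨_, cartanProj_mem i⟩ ⊗ₜ ⟨_, cartanProj_mem i⟩, rfl⟩

end Cartan

/-! ### Root vectors -/

section RootVectors

variable {n : ℕ} {R : Type*} [Field R] {e : Fin n → Fin n → sl (Fin n) R}

theorem IsRootVectorSystem.coe_eq (he : IsRootVectorSystem e) {i j : Fin n} (hij : i ≠ j) :
    (e i j).1 = Matrix.single i j ((e i j).1 i j) := by
  obtain ⟨⟨c, hc⟩, -⟩ := he i j hij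
  rw [hc, Matrix.single_apply_same]

theorem IsRootVectorSystem.mul_eq_one (he : IsRootVectorSystem e) {i j : Fin n} (hij : i ≠ j) :
    (e i j).1 i j * (e j i).1 j i = 1 := by
  have h := (he i j hij).2
  rw [he.coe_eq hij, he.coe_eq hij.symm] at h
  simpa using h

theorem isRootVectorSystem_single :
    IsRootVectorSystem fun i j : Fin n => if h : i ≠ j then single i j h (1 : R) else 0 := by
  intro i j hij
  refine ⟨⟨1, ?_⟩, ?_⟩
  · simp [hij]
  · simp [hij, hij.symm]

theorem toOp_positivePart (he : IsRootVectorSystem e) (x : Matrix (Fin n) (Fin n) R) :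
    toOp (positivePart e) x = Matrix.of fun i j => if i < j then x i j else 0 := by
  have h (i j : Fin n) : toOp (if i < j then e i j ⊗ₜ[R] e j i else 0) x
      = Matrix.single i j (if i < j then x i j else 0) := by
    split_ifs with hij
    · rw [toOp_tmul, he.coe_eq hij.ne, he.coe_eq hij.ne']
      have := he.mul_eq_one hij.ne
      simp only [Matrix.trace_single_mul, Matrix.smul_single, smul_eq_mul]
      congr 1
      linear_combination x i j * this
    · simp
  simp only [positivePart, map_sum, LinearMap.sum_apply, h]
  exact (Matrix.matrix_eq_sum_single _).symm

/-- The normalization tr(e_α e_{−α}) = 1 cancels the scalars of the two root vectors. -/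
theorem positivePart_eq (he : IsRootVectorSystem e) : positivePart e
    = positivePart fun i j : Fin n => if h : i ≠ j then single i j h (1 : R) else 0 := by
  apply toOp_injective
  ext1 x
  rw [toOp_positivePart he, toOp_positivePart isRootVectorSystem_single]

end RootVectors

/-! ### Admissible triples -/

namespace AdmissibleTriple

variable {n : ℕ} (T : AdmissibleTriple n)

theorem Precedes.trans {T : AdmissibleTriple n} {α β γ : Fin n × Fin n} (h₁ : T.Precedes α β)
    (h₂ : T.Precedes β γ) : T.Precedes α γ := by
  obtain ⟨m, hm, hm', hmα⟩ := h₁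
  obtain ⟨l, hl, hl', hlβ⟩ := h₂
  have hadd (k : ℕ) : T.τ^[k + m] '' support α = T.τ^[k] '' support β := by
    rw [Function.iterate_add, Set.image_comp, hmα]
  refine ⟨l + m, by omega, fun k hk => ?_, by rw [hadd, hlβ]⟩
  rcases lt_or_ge k m with hkm | hkm
  · exact hm' k hkm
  · obtain ⟨k, rfl⟩ := Nat.exists_eq_add_of_le' hkm
    rw [hadd]
    exact hl' k (by omega)

/-- A cycle would keep every iterate of the support inside Γ₁, contradicting `exits`. -/
theorem not_precedes_self {α : Fin n × Fin n} (hα : α.1 < α.2) : ¬ T.Precedes α α := by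
  rintro ⟨m, hm, hm', hmα⟩
  have hall (k : ℕ) : T.τ^[k] '' support α ⊆ T.Γ₁ := by
    induction k using Nat.strong_induction_on with
    | _ k ih =>
      rcases lt_or_ge k m with hkm | hkm
      · exact hm' k hkm
      · obtain ⟨k, rfl⟩ := Nat.exists_eq_add_of_le' hkm
        rw [Function.iterate_add, Set.image_comp, hmα]
        exact ih k (by omega)
  have hlt : (α.1 : ℕ) < n - 1 := by have := α.2.2; have : (α.1 : ℕ) < α.2 := hα; omega
  have hmem : (⟨α.1, hlt⟩ : Fin (n - 1)) ∈ support α := ⟨le_rfl, hα⟩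
  obtain ⟨k, hk⟩ := T.exits _ (hall 0 ⟨_, hmem, rfl⟩)
  exact hk (hall k ⟨_, hmem, rfl⟩)

/-- The relation `α ≺ β` of positive roots: `β = τ^m(α)` for some `m ≥ 1`. -/
def Lt (α β : Fin n × Fin n) : Prop := α.1 < α.2 ∧ β.1 < β.2 ∧ T.Precedes α β

instance : IsTrans _ T.Lt := ⟨fun _ _ _ h₁ h₂ => ⟨h₁.1, h₂.2.1, h₁.2.2.trans h₂.2.2⟩⟩

instance : Std.Irrefl T.Lt := ⟨fun _ h => T.not_precedes_self h.1 h.2.2⟩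

theorem wellFounded_lt : WellFounded T.Lt := Finite.wellFounded_of_trans_of_irrefl _

theorem wellFounded_gt : WellFounded (Function.swap T.Lt) :=
  Finite.wellFounded_of_trans_of_irrefl _

/-- The endpoints of the simple root with index `k`. -/
def simplePair (k : Fin (n - 1)) : Fin n × Fin n := (⟨k, by omega⟩, ⟨k + 1, by omega⟩)

theorem simplePair_lt (k : Fin (n - 1)) : (simplePair k).1 < (simplePair k).2 :=
  Fin.mk_lt_mk.mpr (Nat.lt_succ_self _)

theorem support_simplePair (k : Fin (n - 1)) : support (simplePair k) = {k} := by
  ext l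
  simp only [support, simplePair, Set.mem_ofPred_eq, Set.mem_singleton_iff, Fin.ext_iff]
  omega

/-- For k in Γ₁ one has αₖ ≺ τ(αₖ); a symmetric strict order has no such pair. -/
theorem eq_empty_of_lt_symm (h : ∀ α β, T.Lt α β → T.Lt β α) : T.Γ₁ = ∅ := by
  refine Set.eq_empty_iff_forall_notMem.mpr fun k hk => ?_
  have hlt : T.Lt (simplePair k) (simplePair (T.τ k)) := by
    refine ⟨simplePair_lt k, simplePair_lt _, 1, le_rfl, fun l hl => ?_, ?_⟩
    · obtain rfl : l = 0 := by omega
      simpa [support_simplePair] using hk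
    · simp [support_simplePair]
  exact irrefl_of T.Lt _ (_root_.trans hlt (h _ _ hlt))

end AdmissibleTriple

/-! ### The operator of a Belavin--Drinfeld `r`-matrix -/

section Form

variable {n : ℕ} {R : Type*} [Field R]

theorem toOp_wedge {e : Fin n → Fin n → sl (Fin n) R} (he : IsRootVectorSystem e)
    {i j k l : Fin n} (hij : i ≠ j) (hkl : k ≠ l) (x : Matrix (Fin n) (Fin n) R) :
    toOp (wedge (e i j) (e l k)) x = ((e i j).1 i j * (e l k).1 l k) •
      (x k l • Matrix.single i j 1 - x j i • Matrix.single l k 1) := by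
  rw [wedge, map_sub, LinearMap.sub_apply, toOp_tmul, toOp_tmul, he.coe_eq hij, he.coe_eq hkl.symm]
  ext a b
  simp [Matrix.trace_single_mul, Matrix.single_apply]
  split_ifs <;> ring

open Classical in
theorem flip_wedgePart (T : AdmissibleTriple n) (e : Fin n → Fin n → sl (Fin n) R) :
    flip (wedgePart T e) = -wedgePart T e := by
  have h (a b : sl (Fin n) R) : flip (R := R) (wedge a b) = -wedge a b := by
    simp [flip, wedge]
  simp only [wedgePart, map_sum, apply_ite flip, h, map_zero, ← Finset.sum_neg_distrib,
    apply_ite (fun t : sl (Fin n) R ⊗[R] sl (Fin n) R => -t), neg_zero]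

theorem toOp_flip_positivePart {e : Fin n → Fin n → sl (Fin n) R} (he : IsRootVectorSystem e)
    (x : Matrix (Fin n) (Fin n) R) :
    toOp (flip (positivePart e)) x = Matrix.of fun i j => if j < i then x i j else 0 := by
  refine eq_of_forall_trace_mul fun y => ?_
  rw [trace_toOp_flip, toOp_positivePart he]
  simp only [Matrix.trace, Matrix.diag_apply, Matrix.mul_apply, Matrix.of_apply]
  refine Finset.sum_congr rfl fun i _ => Finset.sum_congr rfl fun j _ => ?_
  split_ifs <;> simp

/-- The data describing the operator `f` of a Belavin--Drinfeld `r`-matrix with Cartan part `r₀` and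
coefficients `w α β` of `e_α ∧ e_{-β}`, and its adjoint `f'`. -/
structure HasBDForm (T : AdmissibleTriple n) (f f' : Module.End R (Matrix (Fin n) (Fin n) R))
    (r₀ : sl (Fin n) R ⊗[R] sl (Fin n) R) (w : Fin n × Fin n → Fin n × Fin n → R) : Prop where
  mem : r₀ ∈ cartanTensor n R
  ne_zero_iff : ∀ α β, w α β ≠ 0 ↔ T.Lt α β
  eq : ∀ x, f x = toOp r₀ x + (Matrix.of fun i j => if i < j then x i j else 0)
    + ∑ α, ∑ β, w α β •
      (x β.1 β.2 • Matrix.single α.1 α.2 1 - x α.2 α.1 • Matrix.single β.2 β.1 1)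
  add_adjoint : ∀ x, f x + f' x = x - ((n : R)⁻¹ * x.trace) • (1 : Matrix (Fin n) (Fin n) R)

open Classical in
theorem hasBDForm [CharZero R] (T : AdmissibleTriple n) {r₀ : sl (Fin n) R ⊗[R] sl (Fin n) R}
    {e : Fin n → Fin n → sl (Fin n) R} (he : IsRootVectorSystem e) (hr₀ : r₀ ∈ cartanTensor n R)
    (hr₀' : r₀ + flip r₀ = casimirCartan n R) :
    ∃ w, HasBDForm T (toOp (r₀ + positivePart e + wedgePart T e))
      (toOp (flip (r₀ + positivePart e + wedgePart T e))) r₀ w := by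
  refine ⟨fun α β => if T.Lt α β then (e α.1 α.2).1 α.1 α.2 * (e β.2 β.1).1 β.2 β.1 else 0,
    hr₀, fun α β => ?_, fun x => ?_, fun x => ?_⟩
  · constructor
    · intro h
      by_contra hlt
      exact h (if_neg hlt)
    · intro h
      rw [if_pos h]
      exact mul_ne_zero (left_ne_zero_of_mul_eq_one (he.mul_eq_one h.1.ne))
        (left_ne_zero_of_mul_eq_one (he.mul_eq_one h.2.1.ne'))
  · rw [map_add, map_add, LinearMap.add_apply, LinearMap.add_apply, toOp_positivePart he]
    congr 1
    simp only [wedgePart, map_sum, LinearMap.sum_apply]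
    refine Finset.sum_congr rfl fun α _ => Finset.sum_congr rfl fun β _ => ?_
    by_cases h : T.Lt α β
    · rw [if_pos h, if_pos (show α.1 < α.2 ∧ β.1 < β.2 ∧ T.Precedes α β from h), toOp_wedge he h.1.ne h.2.1.ne]
    · rw [if_neg h, if_neg (show ¬ (α.1 < α.2 ∧ β.1 < β.2 ∧ T.Precedes α β) from h)]
      simp
  · have h : toOp (flip r₀) x = toOp (casimirCartan n R) x - toOp r₀ x := by
      rw [← hr₀', map_add, LinearMap.add_apply, add_sub_cancel_left]
    simp only [map_add, LinearMap.add_apply, toOp_positivePart he, toOp_flip_positivePart he,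
      flip_wedgePart, map_neg, LinearMap.neg_apply, h]
    ext i j
    simp only [Matrix.add_apply, Matrix.sub_apply, Matrix.neg_apply, Matrix.of_apply,
      Matrix.smul_apply, toOp_casimirCartan, smul_eq_mul]
    rcases lt_trichotomy i j with hij | rfl | hij
    · simp [hij, hij.ne, hij.not_gt]
      ring
    · simp
      ring
    · simp [hij, hij.ne', hij.not_gt]
      ring

namespace HasBDForm

variable {T : AdmissibleTriple n} {f f' : Module.End R (Matrix (Fin n) (Fin n) R)}
  {r₀ : sl (Fin n) R ⊗[R] sl (Fin n) R} {w : Fin n × Fin n → Fin n × Fin n → R}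

theorem sum_right_eq_zero (h : HasBDForm T f f' r₀ w) {i j : Fin n} (hij : ¬ i < j)
    (x : Fin n × Fin n → R) : ∑ β, w (i, j) β * x β = 0 := by
  refine Finset.sum_eq_zero fun β _ => ?_
  rw [not_not.mp fun hw => hij ((h.ne_zero_iff (i, j) β).mp hw).1, zero_mul]

theorem sum_left_eq_zero (h : HasBDForm T f f' r₀ w) {i j : Fin n} (hij : ¬ i < j)
    (x : Fin n × Fin n → R) : ∑ α, w α (i, j) * x α = 0 := by
  refine Finset.sum_eq_zero fun α _ => ?_
  rw [not_not.mp fun hw => hij ((h.ne_zero_iff α (i, j)).mp hw).2.1, zero_mul]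

theorem apply_eq (h : HasBDForm T f f' r₀ w) (x : Matrix (Fin n) (Fin n) R)
    (i j : Fin n) :
    f x i j = (if i = j then ∑ k, cartanCoeff r₀ i k * x k k else 0)
      + (if i < j then x i j else 0)
      + (∑ β, w (i, j) β * x β.1 β.2 - ∑ α, w α (j, i) * x α.2 α.1) := by
  rw [h.eq, Matrix.add_apply, Matrix.add_apply, toOp_of_mem_cartanTensor h.mem, Matrix.of_apply]
  congr 1
  simp only [Matrix.sum_apply, Matrix.smul_apply, Matrix.sub_apply, smul_eq_mul, mul_sub]
  simp only [Finset.sum_sub_distrib]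
  congr 1
  · rw [Finset.sum_eq_single (i, j)]
    · simp
    · rintro ⟨a, b⟩ _ hab
      refine Finset.sum_eq_zero fun β _ => ?_
      rw [Matrix.single_apply_of_ne, mul_zero, mul_zero]
      rintro ⟨rfl, rfl⟩
      exact hab rfl
    · simp
  · refine Finset.sum_congr rfl fun α _ => ?_
    rw [Finset.sum_eq_single (j, i)]
    · simp
    · rintro ⟨a, b⟩ _ hab
      rw [Matrix.single_apply_of_ne, mul_zero, mul_zero]
      rintro ⟨rfl, rfl⟩
      exact hab rfl
    · simp

end HasBDForm

end Form

/-! ### Intertwiners of Belavin--Drinfeld operators -/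

namespace HasBDForm

variable {n : ℕ} {R : Type*} [Field R]
variable {T : AdmissibleTriple n} {f f' : Module.End R (Matrix (Fin n) (Fin n) R)}
  {r₀ : sl (Fin n) R ⊗[R] sl (Fin n) R} {w : Fin n × Fin n → Fin n × Fin n → R}

theorem toOp_single_of_ne (h : HasBDForm T f f' r₀ w) {i j : Fin n} (hij : i ≠ j) :
    toOp r₀ (Matrix.single i j 1) = 0 := by
  ext k l
  rw [toOp_of_mem_cartanTensor h.mem, Matrix.zero_apply]
  split_ifs
  · refine Finset.sum_eq_zero fun m _ => ?_
    rw [Matrix.single_apply_of_ne, mul_zero]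
    rintro ⟨rfl, rfl⟩
    exact hij rfl
  · rfl

/-- The image of E_{−α} only involves E_{−β} with α ≺ β: this is nilpotency of `f` on lower
matrices, stated in the form used by the intertwining lemma. -/
theorem apply_single_mem (h : HasBDForm T f f' r₀ w) {i j : Fin n} (hij : j < i)
    (N : Submodule R (Matrix (Fin n) (Fin n) R))
    (hN : ∀ k l, l < k → T.Lt (j, i) (l, k) → Matrix.single k l 1 ∈ N) :
    f (Matrix.single i j 1) ∈ N := by
  have hz : (Matrix.of fun k l => if k < l then Matrix.single i j (1 : R) k l else 0) = 0 := by
    ext k l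
    rw [Matrix.of_apply, Matrix.zero_apply]
    split_ifs with hkl
    · rw [Matrix.single_apply_of_ne]
      rintro ⟨rfl, rfl⟩
      exact hij.not_gt hkl
    · rfl
  rw [h.eq, h.toOp_single_of_ne hij.ne', hz, zero_add, zero_add]
  refine N.sum_mem fun α _ => N.sum_mem fun β _ => ?_
  by_cases hw : w α β = 0
  · rw [hw, zero_smul]
    exact N.zero_mem
  have hlt := (h.ne_zero_iff α β).mp hw
  refine N.smul_mem _ (N.sub_mem ?_ ?_)
  · rw [Matrix.single_apply_of_ne, zero_smul]
    · exact N.zero_mem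
    · rintro ⟨rfl, rfl⟩
      exact hij.not_gt hlt.2.1
  · by_cases hα : α = (j, i)
    · subst hα
      exact N.smul_mem _ (hN _ _ hlt.2.1 hlt)
    · rw [Matrix.single_apply_of_ne, zero_smul]
      · exact N.zero_mem
      · rintro ⟨rfl, rfl⟩
        exact hα rfl

/-- The upper counterpart: (1 − f)E_β only involves E_α with α ≺ β. -/
theorem one_sub_apply_single_mem (h : HasBDForm T f f' r₀ w) {i j : Fin n} (hij : i < j)
    (N : Submodule R (Matrix (Fin n) (Fin n) R))
    (hN : ∀ k l, k < l → T.Lt (k, l) (i, j) → Matrix.single k l 1 ∈ N) :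
    (1 - f) (Matrix.single i j 1) ∈ N := by
  have hz : (Matrix.of fun k l => if k < l then Matrix.single i j (1 : R) k l else 0)
      = Matrix.single i j 1 := by
    ext k l
    rw [Matrix.of_apply]
    split_ifs with hkl
    · rfl
    · rw [Matrix.single_apply_of_ne]
      rintro ⟨rfl, rfl⟩
      exact hkl hij
  rw [LinearMap.sub_apply, Module.End.one_apply, h.eq, h.toOp_single_of_ne hij.ne, hz, zero_add,
    sub_add_cancel_left]
  refine N.neg_mem (N.sum_mem fun α _ => N.sum_mem fun β _ => ?_)
  by_cases hw : w α β = 0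
  · rw [hw, zero_smul]
    exact N.zero_mem
  have hlt := (h.ne_zero_iff α β).mp hw
  refine N.smul_mem _ (N.sub_mem ?_ ?_)
  · by_cases hβ : β = (i, j)
    · subst hβ
      exact N.smul_mem _ (hN _ _ hlt.1 hlt)
    · rw [Matrix.single_apply_of_ne, zero_smul]
      · exact N.zero_mem
      · rintro ⟨rfl, rfl⟩
        exact hβ rfl
  · rw [Matrix.single_apply_of_ne, zero_smul]
    · exact N.zero_mem
    · rintro ⟨rfl, rfl⟩
      exact hij.not_gt hlt.1

theorem apply_upper (h : HasBDForm T f f' r₀ w) {i j : Fin n} (hij : i < j)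
    (x : Matrix (Fin n) (Fin n) R) : f x i j = x i j + ∑ β, w (i, j) β * x β.1 β.2 := by
  rw [h.apply_eq, if_neg hij.ne, if_pos hij,
    h.sum_left_eq_zero hij.not_gt fun α => x α.2 α.1, zero_add, sub_zero]

theorem apply_lower (h : HasBDForm T f f' r₀ w) {i j : Fin n} (hij : j < i)
    (x : Matrix (Fin n) (Fin n) R) : f x i j = -∑ α, w α (j, i) * x α.2 α.1 := by
  rw [h.apply_eq, if_neg hij.ne', if_neg hij.not_gt,
    h.sum_right_eq_zero hij.not_gt fun β => x β.1 β.2, zero_add, zero_add, zero_sub]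

theorem apply_diag (h : HasBDForm T f f' r₀ w) (i : Fin n) (x : Matrix (Fin n) (Fin n) R) :
    f x i i = ∑ k, cartanCoeff r₀ i k * x k k := by
  rw [h.apply_eq, if_pos rfl, if_neg (lt_irrefl i),
    h.sum_left_eq_zero (lt_irrefl i) fun α => x α.2 α.1,
    h.sum_right_eq_zero (lt_irrefl i) fun β => x β.1 β.2, sub_zero, add_zero, add_zero]

theorem apply_upper_eq_self (h : HasBDForm T f f' r₀ w) {i j : Fin n} (hij : i < j)
    (x : Matrix (Fin n) (Fin n) R) (hx : ∀ k l, k < l → T.Lt (i, j) (k, l) → x k l = 0) :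
    f x i j = x i j := by
  rw [h.apply_upper hij, Finset.sum_eq_zero, add_zero]
  intro β _
  by_cases hw : w (i, j) β = 0
  · rw [hw, zero_mul]
  · have hlt := (h.ne_zero_iff _ β).mp hw
    rw [hx _ _ hlt.2.1 hlt, mul_zero]

theorem apply_lower_eq_zero (h : HasBDForm T f f' r₀ w) {i j : Fin n} (hij : j < i)
    (x : Matrix (Fin n) (Fin n) R) (hx : ∀ k l, l < k → T.Lt (l, k) (j, i) → x k l = 0) :
    f x i j = 0 := by
  rw [h.apply_lower hij, Finset.sum_eq_zero, neg_zero]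
  intro α _
  by_cases hw : w α (j, i) = 0
  · rw [hw, zero_mul]
  · have hlt := (h.ne_zero_iff α _).mp hw
    rw [hx _ _ hlt.1 hlt, mul_zero]

theorem adjoint_apply_of_ne (h : HasBDForm T f f' r₀ w) {i j : Fin n} (hij : i ≠ j)
    (x : Matrix (Fin n) (Fin n) R) : f' x i j = x i j - f x i j := by
  have := congrFun (congrFun (h.add_adjoint x) i) j
  simp only [Matrix.add_apply, Matrix.sub_apply, Matrix.smul_apply, Matrix.one_apply_ne hij,
    smul_zero, sub_zero] at this
  rw [← this, add_sub_cancel_left]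

/-- An invertible matrix whose conjugation commutes with a Belavin--Drinfeld operator is
diagonal. -/
theorem isDiag_of_commute (h : HasBDForm T f f' r₀ w) {u v : Matrix (Fin n) (Fin n) R}
    (huv : u * v = 1) (hf : ∀ x, f (u * x * v) = u * f x * v) : u.IsDiag ∧ v.IsDiag := by
  refine isDiag_of_conj_triangular huv ?_ ?_
  · intro i j k l hij hkl
    rw [← mul_single_mul_apply]
    -- 1 − f is nilpotent on upper matrix units and unipotent on lower coordinates; the other half
    -- of the proof uses `f` with upper and lower exchanged.
    refine apply_single_eq_zero_of_intertwine (A := fun i j => i < j) (B := fun i j => j < i)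
      T.wellFounded_lt (InvImage.wf Prod.swap T.wellFounded_lt) (s := 1 - f) (s' := 1 - f)
      (fun x => u * x * v) (by simp) (fun i j hij N hN => h.one_sub_apply_single_mem hij N hN)
      (fun i j hij x hx => ?_) (fun x => ?_) hij hkl
    · rw [LinearMap.sub_apply, Module.End.one_apply, Matrix.sub_apply,
        h.apply_lower_eq_zero hij x hx, sub_zero]
    · simp only [LinearMap.sub_apply, Module.End.one_apply, hf, mul_sub, sub_mul]
  · intro i j k l hij hkl
    rw [← mul_single_mul_apply]
    exact apply_single_eq_zero_of_intertwine (A := fun i j => j < i) (B := fun i j => i < j)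
      (InvImage.wf Prod.swap T.wellFounded_gt) T.wellFounded_gt (s := f) (s' := f)
      (fun x => u * x * v) (by simp) (fun i j hij N hN => h.apply_single_mem hij N hN)
      (fun i j hij x hx => h.apply_upper_eq_self hij x hx) hf hij hkl

/-- An invertible matrix whose conjugation intertwines a conjugate transpose of a Belavin--Drinfeld
operator with its adjoint is diagonal. -/
theorem isDiag_of_intertwine (h : HasBDForm T f f' r₀ w) (γ : R →+* R)
    {u v : Matrix (Fin n) (Fin n) R} (huv : u * v = 1)
    (hf : ∀ x, f' (u * (x.map γ).transpose * v) = u * ((f x).map γ).transpose * v) :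
    u.IsDiag ∧ v.IsDiag := by
  have hsingle (i j : Fin n) : ((Matrix.single j i (1 : R)).map γ).transpose
      = Matrix.single i j 1 := by
    rw [Matrix.map_single, map_one, Matrix.transpose_single]
  refine isDiag_of_conj_triangular huv ?_ ?_
  · intro i j k l hij hkl
    rw [← mul_single_mul_apply, ← hsingle]
    -- The transpose exchanges upper and lower, so `A` and `B` agree here. Off the diagonal f' = 1 −
    -- f, so f' is unipotent on lower coordinates, where `f` is nilpotent.
    refine apply_single_eq_zero_of_intertwine (A := fun i j => j < i) (B := fun i j => j < i)
      (InvImage.wf Prod.swap T.wellFounded_gt) (InvImage.wf Prod.swap T.wellFounded_lt)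
      (s := f) (s' := f') (fun x => u * (x.map γ).transpose * v) (by simp)
      (fun i j hij N hN => h.apply_single_mem hij N hN) (fun i j hij x hx => ?_) hf hij hkl
    rw [h.adjoint_apply_of_ne hij.ne', h.apply_lower_eq_zero hij x hx, sub_zero]
  · intro i j k l hij hkl
    rw [← mul_single_mul_apply, ← hsingle]
    refine apply_single_eq_zero_of_intertwine (A := fun i j => i < j) (B := fun i j => i < j)
      T.wellFounded_lt T.wellFounded_gt (s := 1 - f) (s' := 1 - f')
      (fun x => u * (x.map γ).transpose * v) (by simp)
      (fun i j hij N hN => h.one_sub_apply_single_mem hij N hN)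
      (fun i j hij x hx => ?_) (fun x => ?_) hij hkl
    · rw [LinearMap.sub_apply, Module.End.one_apply, Matrix.sub_apply,
        h.adjoint_apply_of_ne hij.ne, sub_sub_cancel, h.apply_upper_eq_self hij x hx]
    · simp only [LinearMap.sub_apply, Module.End.one_apply, hf, Matrix.map_sub _ (map_sub γ),
        Matrix.transpose_sub, mul_sub, sub_mul]

theorem mul_mul_apply_of_isDiag {u v : Matrix (Fin n) (Fin n) R} (hu : u.IsDiag) (hv : v.IsDiag)
    (x : Matrix (Fin n) (Fin n) R) (i j : Fin n) :
    (u * x * v : Matrix (Fin n) (Fin n) R) i j = u i i * x i j * v j j := by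
  conv_lhs => rw [← hu.diagonal_diag, ← hv.diagonal_diag]
  simp [Matrix.mul_diagonal, Matrix.diagonal_mul]

theorem apply_mul_apply_of_isDiag {u v : Matrix (Fin n) (Fin n) R} (huv : u * v = 1)
    (hu : u.IsDiag) (i : Fin n) : u i i * v i i = 1 := by
  have h : (u * v) i i = u i i * v i i := by
    rw [Matrix.mul_apply, Finset.sum_eq_single i]
    · intro j _ hj
      rw [hu hj.symm, zero_mul]
    · simp
  rw [← h, huv, Matrix.one_apply_eq]

/-- With `u` and `v` diagonal, apply the relation to E_{−α} and read the coordinate at β. It equates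
nonzero multiples of w β α and γ(w α β), so ≺ is symmetric. -/
theorem Γ₁_eq_empty (h : HasBDForm T f f' r₀ w) (γ : R →+* R)
    {u v : Matrix (Fin n) (Fin n) R} (huv : u * v = 1)
    (hf : ∀ x, f' (u * (x.map γ).transpose * v) = u * ((f x).map γ).transpose * v) :
    T.Γ₁ = ∅ := by
  obtain ⟨hu, hv⟩ := h.isDiag_of_intertwine γ huv hf
  have hone (i) := apply_mul_apply_of_isDiag huv hu i
  refine T.eq_empty_of_lt_symm fun α β hαβ => ?_
  obtain ⟨i, j⟩ := α
  obtain ⟨k, l⟩ := β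
  have hij : i < j := hαβ.1
  have hkl : k < l := hαβ.2.1
  have h₁ : f (Matrix.single j i 1) l k = -w (i, j) (k, l) := by
    rw [h.apply_lower hkl, Finset.sum_eq_single (i, j)]
    · simp
    · rintro ⟨a, b⟩ _ hab
      rw [Matrix.single_apply_of_ne, mul_zero]
      rintro ⟨rfl, rfl⟩
      exact hab rfl
    · simp
  have h₂ : f' (Matrix.single i j 1) k l = -w (k, l) (i, j) := by
    rw [h.adjoint_apply_of_ne hkl.ne, h.apply_upper hkl, sub_add_cancel_left,
      Finset.sum_eq_single (i, j)]
    · simp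
    · rintro ⟨a, b⟩ _ hab
      rw [Matrix.single_apply_of_ne, mul_zero]
      rintro ⟨rfl, rfl⟩
      exact hab rfl
    · simp
  have h₃ : u * Matrix.single i j (1 : R) * v = (u i i * v j j) • Matrix.single i j 1 := by
    ext a b
    rw [mul_mul_apply_of_isDiag hu hv, Matrix.smul_apply, Matrix.single_apply]
    split_ifs with hab
    · rw [hab.1, hab.2, smul_eq_mul]
      ring
    · simp
  have h₄ := congrFun (congrFun (hf (Matrix.single j i 1)) k) l
  rw [Matrix.map_single, map_one, Matrix.transpose_single, h₃, map_smul, Matrix.smul_apply, h₂,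
    mul_mul_apply_of_isDiag hu hv, Matrix.transpose_apply, Matrix.map_apply, h₁] at h₄
  rw [← h.ne_zero_iff]
  intro hw
  rw [hw, neg_zero, smul_zero, eq_comm] at h₄
  refine mul_ne_zero (mul_ne_zero (left_ne_zero_of_mul_eq_one (hone k)) ?_)
    (right_ne_zero_of_mul_eq_one (hone l)) h₄
  rw [map_ne_zero, neg_ne_zero, h.ne_zero_iff]
  exact hαβ

/-- Diagonal conjugation fixes Eⱼⱼ, so on diagonal entries the relation reduces to γ(r₀) = Ω₀ − r₀.
-/
theorem map_cartanCoeff [CharZero R] (h : HasBDForm T f f' r₀ w) (γ : R →+* R)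
    {u v : Matrix (Fin n) (Fin n) R} (huv : u * v = 1)
    (hf : ∀ x, f' (u * (x.map γ).transpose * v) = u * ((f x).map γ).transpose * v) (i j : Fin n) :
    γ (cartanCoeff r₀ i j) = cartanCoeff (casimirCartan n R) i j - cartanCoeff r₀ i j := by
  obtain ⟨hu, hv⟩ := h.isDiag_of_intertwine γ huv hf
  have hone (i) := apply_mul_apply_of_isDiag huv hu i
  have h₁ : f (Matrix.single j j 1) i i = cartanCoeff r₀ i j := by
    rw [h.apply_diag, Finset.sum_eq_single j]
    · simp
    · intro k _ hk
      rw [Matrix.single_apply_of_ne, mul_zero]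
      exact fun h => hk h.1.symm
    · simp
  have h₂ : f' (Matrix.single j j 1) i i
      = cartanCoeff (casimirCartan n R) i j - cartanCoeff r₀ i j := by
    have := congrFun (congrFun (h.add_adjoint (Matrix.single j j 1)) i) i
    rw [Matrix.add_apply, h₁] at this
    rw [cartanCoeff, toOp_casimirCartan, if_pos rfl, eq_sub_iff_add_eq, add_comm, this]
    simp
  have h₃ : u * Matrix.single j j (1 : R) * v = Matrix.single j j 1 := by
    ext a b
    rw [mul_mul_apply_of_isDiag hu hv, Matrix.single_apply]
    split_ifs with hab
    · rw [← hab.1, ← hab.2, mul_one, hone]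
    · simp
  have h₄ := congrFun (congrFun (hf (Matrix.single j j 1)) i) i
  rw [Matrix.map_single, map_one, Matrix.transpose_single, h₃, h₂, mul_mul_apply_of_isDiag hu hv,
    Matrix.transpose_apply, Matrix.map_apply, h₁, mul_right_comm, hone, one_mul] at h₄
  exact h₄.symm

end HasBDForm

/-! ### Coboundaries defined over the unitary form -/

/-- `θ` is a `γ`-semilinear Lie automorphism of the matrix algebra compatible with the trace
form. -/
structure IsTraceAut {n : ℕ} {L : Type*} [Field L] (γ : L ≃+* L)
    (θ : Matrix (Fin n) (Fin n) L ≃+ Matrix (Fin n) (Fin n) L) : Prop where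
  map_smul : ∀ (c : L) x, θ (c • x) = γ c • θ x
  map_lie : ∀ x y, θ ⁅x, y⁆ = ⁅θ x, θ y⁆
  trace_mul : ∀ x y, (θ x * θ y).trace = γ (x * y).trace
  trace_mul_trace : ∀ x y, (θ x).trace * (θ y).trace = γ (x.trace * y.trace)
  symm_one : ∃ c : L, θ.symm 1 = c • (1 : Matrix (Fin n) (Fin n) L)

section TraceAut

variable {n : ℕ} {L : Type*} [Field L] (γ : L ≃+* L)

theorem isTraceAut_map : IsTraceAut γ (γ.toAddEquiv.mapMatrix : Matrix (Fin n) (Fin n) L ≃+ _) where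
  map_smul c x := by ext; simp
  map_lie x y := by
    have h (x y : Matrix (Fin n) (Fin n) L) : (x * y).map γ = x.map γ * y.map γ := Matrix.map_mul
    simp [Ring.lie_def, Matrix.map_sub _ (map_sub γ), h]
  trace_mul x y := by
    have h : (x * y).map γ = x.map γ * y.map γ := Matrix.map_mul
    simp only [AddEquiv.mapMatrix_apply, RingEquiv.toAddEquiv_eq_coe, RingEquiv.coe_toAddEquiv, ← h]
    exact (AddMonoidHom.map_trace γ (x * y)).symm
  trace_mul_trace x y := by
    rw [map_mul]
    congr 1 <;> exact (AddMonoidHom.map_trace γ _).symm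
  symm_one := by
    refine ⟨1, ?_⟩
    rw [AddEquiv.symm_apply_eq]
    ext i j
    simp [Matrix.one_apply, apply_ite γ]

/-- The map `x ↦ -γ(x)ᵀ` on matrices. -/
def negConjTranspose : Matrix (Fin n) (Fin n) L ≃+ Matrix (Fin n) (Fin n) L :=
  (γ.toAddEquiv.mapMatrix.trans (Matrix.transposeAddEquiv _ _ _)).trans (AddEquiv.neg _)

theorem negConjTranspose_apply (x : Matrix (Fin n) (Fin n) L) :
    negConjTranspose γ x = -(x.map γ).transpose := rfl

theorem isTraceAut_negConjTranspose :
    IsTraceAut γ (negConjTranspose γ : Matrix (Fin n) (Fin n) L ≃+ _) where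
  map_smul c x := by ext; simp [negConjTranspose_apply]
  map_lie x y := by
    have h (x y : Matrix (Fin n) (Fin n) L) : (x * y).map γ = x.map γ * y.map γ := Matrix.map_mul
    simp [negConjTranspose_apply, Ring.lie_def, Matrix.map_sub _ (map_sub γ), h]
  trace_mul x y := by
    have h (x y : Matrix (Fin n) (Fin n) L) : (x * y).map γ = x.map γ * y.map γ := Matrix.map_mul
    rw [negConjTranspose_apply, negConjTranspose_apply, neg_mul_neg, ← Matrix.transpose_mul, ← h,
      Matrix.trace_transpose, Matrix.trace_mul_comm x]
    exact (AddMonoidHom.map_trace γ (y * x)).symm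
  trace_mul_trace x y := by
    rw [negConjTranspose_apply, negConjTranspose_apply, Matrix.trace_neg, Matrix.trace_neg,
      neg_mul_neg, Matrix.trace_transpose, Matrix.trace_transpose, map_mul]
    congr 1 <;> exact (AddMonoidHom.map_trace γ _).symm
  symm_one := by
    refine ⟨-1, ?_⟩
    rw [AddEquiv.symm_apply_eq, negConjTranspose_apply]
    ext i j
    simp [Matrix.one_apply, apply_ite γ, eq_comm]

end TraceAut

section Descent

variable {F K L : Type*} [Field F] [Field K] [Algebra F K] [Field L] [Algebra F L]
  [Algebra K L] [IsScalarTower F K L] {n : ℕ} {σ : K ≃ₐ[F] K}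

@[simp]
theorem suIncl_coe (a : su n σ) : (suIncl L a).1 = a.1.map (algebraMap K L) := rfl

theorem toOp_map_suIncl {γ : L ≃+* L} {θ : Matrix (Fin n) (Fin n) L ≃+ Matrix (Fin n) (Fin n) L}
    (hθ : IsTraceAut γ θ) (hfix : ∀ a : su n σ, θ (suIncl L a).1 = (suIncl L a).1)
    (t : su n σ ⊗[F] su n σ) (x : Matrix (Fin n) (Fin n) L) :
    toOp (TensorProduct.map (suIncl L) (suIncl L) t) (θ x)
      = θ (toOp (TensorProduct.map (suIncl L) (suIncl L) t) x) := by
  induction t using TensorProduct.induction_on with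
  | zero => simp
  | add r s hr hs => simp only [map_add, LinearMap.add_apply, hr, hs]
  | tmul a b =>
    simp only [TensorProduct.map_tmul, toOp_tmul, hθ.map_smul, hfix]
    conv_lhs => rw [← hfix b, hθ.trace_mul]

/-- Eᵢⱼ − Eⱼᵢ and q(Eᵢⱼ + Eⱼᵢ) lie in su and together yield Eᵢⱼ over `L`. -/
theorem single_mem_of_suIncl_mem [CharZero F] {q : K} (hq : q ≠ 0) (hσ : σ q = -q)
    (N : Submodule L (Matrix (Fin n) (Fin n) L)) (hN : ∀ a : su n σ, (suIncl L a).1 ∈ N)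
    {i j : Fin n} (hij : i ≠ j) : Matrix.single i j 1 ∈ N := by
  have : CharZero K := charZero_of_injective_algebraMap (algebraMap F K).injective
  have : CharZero L := charZero_of_injective_algebraMap (algebraMap K L).injective
  have hq' : algebraMap K L q ≠ 0 := by simpa using hq
  have h₁ : (Matrix.single i j 1 - Matrix.single j i 1 : Matrix (Fin n) (Fin n) K) ∈ su n σ := by
    refine ⟨?_, ?_⟩
    · refine (LinearMap.mem_ker (f := Matrix.traceLinearMap (Fin n) K K)).mpr ?_
      simp [Matrix.trace_single_eq_of_ne, hij, hij.symm]
    · rw [Matrix.map_sub _ (map_sub σ)]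
      simp
  have h₂ : (Matrix.single i j q + Matrix.single j i q : Matrix (Fin n) (Fin n) K) ∈ su n σ := by
    refine ⟨?_, ?_⟩
    · refine (LinearMap.mem_ker (f := Matrix.traceLinearMap (Fin n) K K)).mpr ?_
      simp [Matrix.trace_single_eq_of_ne, hij, hij.symm]
    · rw [Matrix.map_add _ (map_add σ)]
      ext a b
      simp [hσ, Matrix.single_apply]
      split_ifs <;> ring
  have h : Matrix.single i j (1 : L) = (2 : L)⁻¹ • ((suIncl L (⟨_, h₁⟩ : su n σ)).1
      + (algebraMap K L q)⁻¹ • (suIncl L (⟨_, h₂⟩ : su n σ)).1) := by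
    ext a b
    simp [Matrix.single_apply]
    split_ifs <;> simp [hq'] <;> field_simp <;> ring
  rw [h]
  exact N.smul_mem _ (N.add_mem (hN _) (N.smul_mem _ (hN _)))

theorem toOp_one {R : Type*} [Field R] (r : sl (Fin n) R ⊗[R] sl (Fin n) R) : toOp r 1 = 0 := by
  induction r using TensorProduct.induction_on with
  | zero => simp
  | add r s hr hs => rw [map_add, LinearMap.add_apply, hr, hs, add_zero]
  | tmul a b =>
    have hb : b.1.trace = 0 := b.2
    rw [toOp_tmul, mul_one, hb, zero_smul]

/-- The coboundary determines the operator up to ad-invariants, and its symmetric part is known.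
Transport by θ multiplies the symmetric part by γ(p) in place of p; the term with (p − γ(p))/2
compensates for this. -/
theorem coboundary_commute [CharZero F] {q : K} (hq : q ≠ 0) (hσ : σ q = -q)
    {γ : L ≃+* L} {θ : Matrix (Fin n) (Fin n) L ≃+ Matrix (Fin n) (Fin n) L}
    (hθ : IsTraceAut γ θ) (hfix : ∀ a : su n σ, θ (suIncl L a).1 = (suIncl L a).1)
    {δ : su n σ →ₗ[F] su n σ ⊗[F] su n σ} {p : L} {r : sl (Fin n) L ⊗[L] sl (Fin n) L}
    (hδ : IsScalarExtension δ (coboundary (p • r)))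
    (hr : ∀ x, toOp r x + toOp (flip r) x
      = x - ((n : L)⁻¹ * x.trace) • (1 : Matrix (Fin n) (Fin n) L))
    (x : Matrix (Fin n) (Fin n) L) :
    γ p • θ (toOp r x) = p • toOp r (θ x)
      - ((p - γ p) / 2) • (toOp r (θ x) + toOp (flip r) (θ x)) := by
  have : CharZero K := charZero_of_injective_algebraMap (algebraMap F K).injective
  have : CharZero L := charZero_of_injective_algebraMap (algebraMap K L).injective
  -- The transport θ ∘ (p f) ∘ θ⁻¹ is linear again, since the twists by γ and γ⁻¹ cancel.
  let g : Module.End L (Matrix (Fin n) (Fin n) L) :=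
    { toFun := fun x => θ (p • toOp r (θ.symm x))
      map_add' := fun x y => by simp
      map_smul' := fun c x => by
        have h : θ.symm (c • x) = γ.symm c • θ.symm x := by
          rw [AddEquiv.symm_apply_eq, hθ.map_smul]
          simp
        rw [h, LinearMap.map_smul, smul_comm p, hθ.map_smul, RingEquiv.apply_symm_apply, RingHom.id_apply] }
  have hg (x) : g x = θ (p • toOp r (θ.symm x)) := rfl
  -- This combination is skew: its symmetric part is (γ(p) − p)/2 + (p − γ(p))/2 = 0 times f + f'.
  let t := g - p • toOp r + ((p - γ p) / 2) • (toOp r + toOp (flip r))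
  have ht (x) : t x = g x - p • toOp r x + ((p - γ p) / 2) • (toOp r x + toOp (flip r) x) := rfl
  have hsu (a : su n σ) (y : Matrix (Fin n) (Fin n) L) :
      t ⁅(suIncl L a).1, y⁆ = ⁅(suIncl L a).1, t y⁆ := by
    have h₁ (x : Matrix (Fin n) (Fin n) L) :
        toOp (TensorProduct.map (suIncl L) (suIncl L) (δ a)) x
          = p • toOp r ⁅(suIncl L a).1, x⁆ - ⁅(suIncl L a).1, p • toOp r x⁆ := by
      rw [← hδ a, coboundary_apply, map_neg, LinearMap.neg_apply, toOp_lie, map_smul]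
      simp
    have h₂ := toOp_map_suIncl hθ hfix (δ a) (θ.symm y)
    have h₃ : ⁅(suIncl L a).1, θ.symm y⁆ = θ.symm ⁅(suIncl L a).1, y⁆ := by
      rw [AddEquiv.eq_symm_apply, hθ.map_lie, hfix, AddEquiv.apply_symm_apply]
    rw [h₁, h₁, map_sub, hθ.map_lie, hfix, AddEquiv.apply_symm_apply, h₃, ← hg, ← hg] at h₂
    have h₄ : toOp r ⁅(suIncl L a).1, y⁆ + toOp (flip r) ⁅(suIncl L a).1, y⁆
        = ⁅(suIncl L a).1, toOp r y + toOp (flip r) y⁆ := by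
      rw [hr, hr, LieAlgebra.matrix_trace_commutator_zero]
      simp [Ring.lie_def, mul_sub, sub_mul]
    rw [ht, ht, h₄, lie_add _ (g y - p • toOp r y), lie_sub,
      lie_smul ((p - γ p) / 2)]
    congr 1
    rw [sub_eq_sub_iff_add_eq_add] at h₂ ⊢
    rw [← h₂, add_comm]
  have htz : t = 0 := by
    refine eq_zero_of_commute_of_skew t ?_ ?_ ?_
    · intro i j hij
      let N : Submodule L (Matrix (Fin n) (Fin n) L) :=
        { carrier := {z | ∀ x, t ⁅z, x⁆ = ⁅z, t x⁆}
          add_mem' := fun ha hb x => by simp only [add_lie, map_add, ha x, hb x]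
          zero_mem' := fun x => by simp
          smul_mem' := fun c z hz x => by simp only [smul_lie, map_smul, hz x] }
      exact single_mem_of_suIncl_mem hq hσ N hsu hij
    · have hP (x y : Matrix (Fin n) (Fin n) L) : (toOp r x * y).trace + (x * toOp r y).trace
          = (x * y).trace - (n : L)⁻¹ * (x.trace * y.trace) := by
        rw [← trace_toOp_flip, ← Matrix.trace_add, ← add_mul, hr]
        simp [sub_mul]
        ring
      have hP' (x y : Matrix (Fin n) (Fin n) L) :
          ((toOp r x + toOp (flip r) x) * y).trace
            = (x * y).trace - (n : L)⁻¹ * (x.trace * y.trace) := by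
        rw [hr]
        simp [sub_mul]
        ring
      have hP'' (x y : Matrix (Fin n) (Fin n) L) :
          (x * (toOp r y + toOp (flip r) y)).trace
            = (x * y).trace - (n : L)⁻¹ * (x.trace * y.trace) := by
        rw [hr]
        simp [mul_sub]
        ring
      intro x y
      have hg' : (g x * y).trace + (x * g y).trace
          = γ p * ((x * y).trace - (n : L)⁻¹ * (x.trace * y.trace)) := by
        have h₁ : (g x * y).trace = γ (p * (toOp r (θ.symm x) * θ.symm y).trace) := by
          conv_lhs => rw [← θ.apply_symm_apply y, hg, hθ.trace_mul]
          simp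
        have h₂ : (x * g y).trace = γ (p * (θ.symm x * toOp r (θ.symm y)).trace) := by
          conv_lhs => rw [← θ.apply_symm_apply x, hg, hθ.trace_mul]
          simp
        rw [h₁, h₂, ← map_add, ← mul_add, hP, map_mul, map_sub, map_mul, ← hθ.trace_mul,
          ← hθ.trace_mul_trace]
        simp
      have := hP x y
      simp only [ht, add_mul, sub_mul, mul_add, mul_sub, Matrix.trace_add, Matrix.trace_sub,
        Matrix.smul_mul, Matrix.mul_smul, Matrix.trace_smul, smul_eq_mul] at hP' hP'' ⊢
      linear_combination hg' - p * this + ((p - γ p) / 2) * (hP' x y + hP'' x y)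
    · obtain ⟨c, hc⟩ := hθ.symm_one
      rw [ht, hg, hc, LinearMap.map_smul, toOp_one, toOp_one]
      simp
  have h := ht (θ x)
  rw [htz, LinearMap.zero_apply, hg, AddEquiv.symm_apply_apply, hθ.map_smul] at h
  rw [eq_comm, sub_add_eq_add_sub, sub_eq_zero] at h
  exact eq_sub_of_add_eq h

end Descent

/-! ### Quadratic extensions -/

section Quadratic

variable {F K : Type*} [Field F] [Field K] [Algebra F K] {q : K} {d : F} {σ : K ≃ₐ[F] K}

theorem exists_eq_add_mul (hq : q ^ 2 = algebraMap F K d)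
    (hK : IntermediateField.adjoin F {q} = ⊤) (y : K) :
    ∃ a b : F, y = algebraMap F K a + algebraMap F K b * q := by
  have hint : IsIntegral F q := .of_pow two_pos (hq ▸ isIntegral_algebraMap)
  have hy : y ∈ Algebra.adjoin F {q} := by
    rw [← IntermediateField.adjoin_simple_toSubalgebra_of_isAlgebraic hint.isAlgebraic, hK]
    exact Algebra.mem_top
  induction hy using Algebra.adjoin_induction with
  | mem x hx => exact ⟨0, 1, by simpa using hx⟩
  | algebraMap r => exact ⟨r, 0, by simp⟩
  | add x y _ _ hx hy =>
    obtain ⟨a, b, rfl⟩ := hx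
    obtain ⟨a', b', rfl⟩ := hy
    exact ⟨a + a', b + b', by simp only [map_add]; ring⟩
  | mul x y _ _ hx hy =>
    obtain ⟨a, b, rfl⟩ := hx
    obtain ⟨a', b', rfl⟩ := hy
    refine ⟨a * a' + b * b' * d, a * b' + a' * b, ?_⟩
    simp only [map_add, map_mul]
    rw [← hq]
    ring

theorem apply_eq_neg (hq : q ^ 2 = algebraMap F K d) (hK : IntermediateField.adjoin F {q} = ⊤)
    (hσ : σ ≠ AlgEquiv.refl) : σ q = -q := by
  have h : σ q ^ 2 = q ^ 2 := by rw [← map_pow, hq, AlgEquiv.commutes]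
  refine (sq_eq_sq_iff_eq_or_eq_neg.mp h).resolve_left fun h => hσ ?_
  ext y
  obtain ⟨a, b, rfl⟩ := exists_eq_add_mul hq hK y
  simp [h]

theorem apply_apply_eq (hq : q ^ 2 = algebraMap F K d) (hK : IntermediateField.adjoin F {q} = ⊤)
    (hσ : σ q = -q) (y : K) : σ (σ y) = y := by
  obtain ⟨a, b, rfl⟩ := exists_eq_add_mul hq hK y
  simp [hσ]

theorem mem_range_of_apply_eq [CharZero F] (hq : q ^ 2 = algebraMap F K d)
    (hK : IntermediateField.adjoin F {q} = ⊤) (hq0 : q ≠ 0)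
    (hσ : σ q = -q) {y : K} (hy : σ y = y) : ∃ a : F, algebraMap F K a = y := by
  have : CharZero K := charZero_of_injective_algebraMap (algebraMap F K).injective
  obtain ⟨a, b, rfl⟩ := exists_eq_add_mul hq hK y
  simp only [map_add, map_mul, AlgEquiv.commutes, hσ] at hy
  have hb : algebraMap F K b = 0 := by
    have h : algebraMap F K b * (2 * q) = 0 := by linear_combination -hy
    exact (mul_eq_zero.mp h).resolve_right (mul_ne_zero two_ne_zero hq0)
  exact ⟨a, by rw [hb, zero_mul, add_zero]⟩

end Quadratic

/-! ### The case of an empty triple -/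

theorem AdmissibleTriple.not_lt_of_eq_empty {n : ℕ} (T : AdmissibleTriple n) (hT : T.Γ₁ = ∅)
    (α β : Fin n × Fin n) : ¬ T.Lt α β := by
  rintro ⟨hα, -, m, hm, hm', -⟩
  have hlt : (α.1 : ℕ) < n - 1 := by have := α.2.2; have : (α.1 : ℕ) < α.2 := hα; omega
  have hmem : (⟨α.1, hlt⟩ : Fin (n - 1)) ∈ support α := ⟨le_rfl, hα⟩
  simpa [hT] using hm' 0 hm ⟨_, hmem, rfl⟩

theorem wedgePart_eq_zero {n : ℕ} {R : Type*} [Field R] {T : AdmissibleTriple n} (hT : T.Γ₁ = ∅)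
    (e : Fin n → Fin n → sl (Fin n) R) : wedgePart T e = 0 :=
  Finset.sum_eq_zero fun α _ => Finset.sum_eq_zero fun β _ => if_neg (T.not_lt_of_eq_empty hT α β)

namespace HasBDForm

variable {n : ℕ} {R : Type*} [Field R]
variable {T : AdmissibleTriple n} {f f' : Module.End R (Matrix (Fin n) (Fin n) R)}
  {r₀ : sl (Fin n) R ⊗[R] sl (Fin n) R} {w : Fin n × Fin n → Fin n × Fin n → R}

theorem apply_eq_of_empty (h : HasBDForm T f f' r₀ w) (hT : T.Γ₁ = ∅)
    (x : Matrix (Fin n) (Fin n) R) (i j : Fin n) :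
    f x i j = if i < j then x i j else if i = j then ∑ k, cartanCoeff r₀ i k * x k k else 0 := by
  rcases lt_trichotomy i j with hij | rfl | hij
  · rw [if_pos hij, h.apply_upper_eq_self hij x fun k l _ hkl => (T.not_lt_of_eq_empty hT _ _ hkl).elim]
  · rw [if_neg (lt_irrefl i), if_pos rfl, h.apply_diag]
  · rw [if_neg hij.not_gt, if_neg hij.ne',
      h.apply_lower_eq_zero hij x fun k l _ hkl => (T.not_lt_of_eq_empty hT _ _ hkl).elim]

/-- Without wedge terms `f` acts entrywise off the diagonal and preserves the diagonal matrices,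
which the torus fixes. -/
theorem apply_conj_of_isDiag (h : HasBDForm T f f' r₀ w) (hT : T.Γ₁ = ∅)
    {u v : Matrix (Fin n) (Fin n) R} (huv : u * v = 1) (hu : u.IsDiag) (hv : v.IsDiag)
    (x : Matrix (Fin n) (Fin n) R) : f (u * x * v) = u * f x * v := by
  have hone (i) := apply_mul_apply_of_isDiag huv hu i
  ext i j
  simp only [h.apply_eq_of_empty hT, mul_mul_apply_of_isDiag hu hv, mul_right_comm _ (_ : R) (v _ _),
    hone, one_mul]
  split_ifs with h₁ h₂
  · rfl
  · subst h₂
    rw [hone, one_mul]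
  · rw [mul_zero]

theorem apply_map (h : HasBDForm T f f' r₀ w) (hT : T.Γ₁ = ∅) (γ : R ≃+* R)
    (hγ : ∀ i j, γ (cartanCoeff r₀ i j) = cartanCoeff r₀ i j) (x : Matrix (Fin n) (Fin n) R) :
    f (x.map γ) = (f x).map γ := by
  ext i j
  simp only [h.apply_eq_of_empty hT, Matrix.map_apply, apply_ite γ, map_sum, map_mul, hγ, map_zero]

end HasBDForm

/-- A matrix over `L` whose columns are multiplied by scalars under all automorphisms of `L` over
`K` becomes defined over `K` after scaling its columns. -/
theorem exists_map_eq_mul_diagonal {K L : Type*} [Field K] [Field L] [Algebra K L] [IsGalois K L]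
    {n : ℕ} (X : GL (Fin n) L)
    (hX : ∀ γ : L ≃ₐ[K] L, ∃ u : Matrix (Fin n) (Fin n) L, u.IsDiag ∧ X.1.map γ = X.1 * u) :
    ∃ (X' : GL (Fin n) K) (D : GL (Fin n) L), D.1.IsDiag ∧ D⁻¹.1.IsDiag ∧
      X'.map (algebraMap K L) = X * D := by
  have hcol (j : Fin n) : ∃ i, X.1 i j ≠ 0 := by
    by_contra! h
    have h₁ : (X⁻¹.1 * X.1) j j = 0 := by
      rw [Matrix.mul_apply]
      exact Finset.sum_eq_zero fun i _ => by rw [h, mul_zero]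
    simp at h₁
  choose p hp using hcol
  -- Divide each column by one chosen nonzero entry. An automorphism scales a whole column by the
  -- same factor, so the ratios are Galois-fixed: an explicit Hilbert 90 for the torus.
  let D : GL (Fin n) L := ⟨Matrix.diagonal fun j => (X.1 (p j) j)⁻¹,
    Matrix.diagonal fun j => X.1 (p j) j, by simp [hp], by simp [hp]⟩
  have hent (i j) : (X * D).1 i j = X.1 i j * (X.1 (p j) j)⁻¹ :=
    Matrix.mul_diagonal _ _ i j
  have hfix (i j) : ∃ c : K, algebraMap K L c = (X * D).1 i j := by
    refine (InfiniteGalois.mem_range_algebraMap_iff_fixed _).mpr fun γ => ?_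
    obtain ⟨u, hu, hγ⟩ := hX γ
    have hγ' (i j) : γ (X.1 i j) = X.1 i j * u j j := by
      have := congrFun (congrFun hγ i) j
      rw [Matrix.map_apply, Matrix.mul_apply, Finset.sum_eq_single j] at this
      · exact this
      · intro k _ hk
        rw [hu hk, mul_zero]
      · simp
    have hu0 : u j j ≠ 0 := by
      have h := (map_ne_zero γ).mpr (hp j)
      rw [hγ'] at h
      exact right_ne_zero_of_mul h
    rw [hent, map_mul, map_inv₀, hγ', hγ', mul_inv, mul_mul_mul_comm, mul_inv_cancel₀ hu0, mul_one]
  choose c hc using hfix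
  have hmap : (Matrix.of c).map (algebraMap K L) = (X * D).1 := by
    ext i j
    exact hc i j
  have hdet : (Matrix.of c).det ≠ 0 := by
    intro h
    have h₁ : (X * D).1.det = 0 := by
      rw [← hmap, ← RingHom.mapMatrix_apply, ← RingHom.map_det, h, map_zero]
    exact (X * D).det_ne_zero h₁
  refine ⟨Matrix.GeneralLinearGroup.mkOfDetNeZero (Matrix.of c) hdet, D,
    Matrix.isDiag_diagonal _, Matrix.isDiag_diagonal _, ?_⟩
  apply Units.ext
  exact hmap

/-! ### Consequences of being defined over the unitary form -/

section Main

variable {F K L : Type*} [Field F] [CharZero F] [Field K] [Algebra F K] [Field L] [Algebra F L]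
  [Algebra K L] [IsScalarTower F K L] {n : ℕ} {σ : K ≃ₐ[F] K} {q : K}
  {δ : su n σ →ₗ[F] su n σ ⊗[F] su n σ} {r : sl (Fin n) L ⊗[L] sl (Fin n) L} {X : GL (Fin n) L}

theorem toOp_Ad₂_add_flip {R : Type*} [Field R] {r : sl (Fin n) R ⊗[R] sl (Fin n) R}
    (hr : ∀ x, toOp r x + toOp (flip r) x
      = x - ((n : R)⁻¹ * x.trace) • (1 : Matrix (Fin n) (Fin n) R)) (X : GL (Fin n) R)
    (x : Matrix (Fin n) (Fin n) R) : toOp (Ad₂ X r) x + toOp (flip (Ad₂ X r)) x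
      = x - ((n : R)⁻¹ * x.trace) • (1 : Matrix (Fin n) (Fin n) R) := by
  rw [flip_Ad₂, toOp_Ad₂, toOp_Ad₂, ← add_mul, ← mul_add, hr, Matrix.trace_mul_cycle,
    Units.mul_inv, one_mul]
  simp [mul_sub, sub_mul, mul_assoc]

theorem toOp_conj_map (hq : q ≠ 0) (hσ : σ q = -q) {γ : L ≃+* L}
    (hγ : ∀ k, γ (algebraMap K L k) = algebraMap K L k)
    (hδ : IsScalarExtension δ (coboundary (algebraMap K L q • Ad₂ X r)))
    (hr : ∀ x, toOp r x + toOp (flip r) x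
      = x - ((n : L)⁻¹ * x.trace) • (1 : Matrix (Fin n) (Fin n) L))
    (x : Matrix (Fin n) (Fin n) L) :
    toOp r (X⁻¹.1 * X.1.map γ * x.map γ * (X⁻¹.1.map γ * X.1))
      = X⁻¹.1 * X.1.map γ * (toOp r x).map γ * (X⁻¹.1.map γ * X.1) := by
  have hmul (x y : Matrix (Fin n) (Fin n) L) : (x * y).map γ = x.map γ * y.map γ := Matrix.map_mul
  have hq' : algebraMap K L q ≠ 0 := by simpa using hq
  have hfix (a : su n σ) : γ.toAddEquiv.mapMatrix (suIncl L a).1 = (suIncl L a).1 := by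
    ext i j
    simp [hγ]
  have h := coboundary_commute hq hσ (isTraceAut_map γ) hfix hδ (toOp_Ad₂_add_flip hr X)
    (X.1 * x * X⁻¹.1)
  rw [hγ, sub_self, zero_div, zero_smul, sub_zero, (smul_right_injective _ hq').eq_iff] at h
  replace h : (toOp (Ad₂ X r) (X.1 * x * X⁻¹.1)).map γ
    = toOp (Ad₂ X r) ((X.1 * x * X⁻¹.1).map γ) := h
  rw [toOp_Ad₂, toOp_Ad₂] at h
  simp only [hmul, mul_assoc, Units.inv_mul_cancel_left, Units.inv_mul, mul_one] at h
  have h' := congrArg (fun y => X⁻¹.1 * (y * X.1)) h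
  simp only [mul_assoc, Units.inv_mul_cancel_left, Units.inv_mul, mul_one] at h' ⊢
  exact h'.symm

theorem toOp_conj_transpose (hq : q ≠ 0) (hσ : σ q = -q) {γ : L ≃+* L}
    (hγ : ∀ k, γ (algebraMap K L k) = algebraMap K L (σ k))
    (hδ : IsScalarExtension δ (coboundary (algebraMap K L q • Ad₂ X r)))
    (hr : ∀ x, toOp r x + toOp (flip r) x
      = x - ((n : L)⁻¹ * x.trace) • (1 : Matrix (Fin n) (Fin n) L))
    (x : Matrix (Fin n) (Fin n) L) :
    toOp (flip r) (X⁻¹.1 * (X⁻¹.1.map γ).transpose * (x.map γ).transpose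
        * ((X.1.map γ).transpose * X.1))
      = X⁻¹.1 * (X⁻¹.1.map γ).transpose * ((toOp r x).map γ).transpose
        * ((X.1.map γ).transpose * X.1) := by
  have : CharZero L := charZero_of_injective_algebraMap (algebraMap F L).injective
  have hmul (x y : Matrix (Fin n) (Fin n) L) :
      ((x * y).map γ).transpose = (y.map γ).transpose * (x.map γ).transpose := by
    rw [← Matrix.transpose_mul]
    exact congrArg _ Matrix.map_mul
  have hq' : algebraMap K L q ≠ 0 := by simpa using hq
  have hfix (a : su n σ) : negConjTranspose γ (suIncl L a).1 = (suIncl L a).1 := by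
    ext i j
    have := congrFun (congrFun a.2.2 i) j
    simp only [Matrix.add_apply, Matrix.transpose_apply, Matrix.map_apply, Matrix.zero_apply] at this
    rw [negConjTranspose_apply, suIncl_coe, Matrix.neg_apply, Matrix.transpose_apply,
      Matrix.map_apply, Matrix.map_apply, Matrix.map_apply, hγ, ← map_neg,
      neg_eq_of_add_eq_zero_right this]
  have h := coboundary_commute hq hσ (isTraceAut_negConjTranspose γ) hfix hδ
    (toOp_Ad₂_add_flip hr X) (X.1 * x * X⁻¹.1)
  -- Here γ(p) = −p, so the correction is p(f + f'), and subtracting it from p f leaves −p f': the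
  -- adjoint appears.
  rw [hγ, hσ, map_neg, sub_neg_eq_add, add_self_div_two, ← smul_sub, sub_add_cancel_left, neg_smul,
    smul_neg, neg_inj, (smul_right_injective _ hq').eq_iff, negConjTranspose_apply,
    negConjTranspose_apply, map_neg, neg_inj, flip_Ad₂, toOp_Ad₂, toOp_Ad₂] at h
  simp only [hmul, mul_assoc, Units.inv_mul_cancel_left, Units.inv_mul, mul_one] at h
  have h' := congrArg (fun y => X⁻¹.1 * (y * X.1)) h
  simp only [mul_assoc, Units.inv_mul_cancel_left, Units.inv_mul, mul_one] at h' ⊢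
  exact h'.symm

theorem Ad₂_mul_of_isDiag {R : Type*} [Field R] {T : AdmissibleTriple n}
    {r r₀ : sl (Fin n) R ⊗[R] sl (Fin n) R} {w : Fin n × Fin n → Fin n × Fin n → R}
    (h : HasBDForm T (toOp r) (toOp (flip r)) r₀ w) (hT : T.Γ₁ = ∅) (X D : GL (Fin n) R)
    (hD : D.1.IsDiag) (hD' : D⁻¹.1.IsDiag) : Ad₂ (X * D) r = Ad₂ X r := by
  apply toOp_injective
  ext1 x
  have hmul : (X * D).1 = X.1 * D.1 := rfl
  have hinv : (X * D)⁻¹.1 = D⁻¹.1 * X⁻¹.1 := by rw [mul_inv_rev]; rfl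
  have h₁ := h.apply_conj_of_isDiag hT D.inv_mul hD' hD (X⁻¹.1 * x * X.1)
  rw [toOp_Ad₂, toOp_Ad₂, hmul, hinv]
  simp only [mul_assoc] at h₁ ⊢
  rw [h₁]
  simp only [mul_assoc, Units.mul_inv_cancel_left]

theorem conj_mul_conj_eq_one {R : Type*} [Field R] (γ : R ≃+* R) (X : GL (Fin n) R) :
    X⁻¹.1 * (X⁻¹.1.map γ).transpose * ((X.1.map γ).transpose * X.1) = 1 := by
  have h : (X⁻¹.1.map γ).transpose * (X.1.map γ).transpose = 1 := by
    rw [← Matrix.transpose_mul]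
    have : X.1.map γ * X⁻¹.1.map γ = (X.1 * X⁻¹.1).map γ := Matrix.map_mul.symm
    rw [this, Units.mul_inv, Matrix.map_one _ (map_zero γ) (map_one γ), Matrix.transpose_one]
  rw [mul_assoc, ← mul_assoc _ _ X.1, h, one_mul, Units.inv_mul]

end Main

/-- The tensor `r₀ - Ω₀ / 2` is defined over `K` if the coefficients of `r₀` are. -/
theorem exists_skew_tensor {F K L : Type*} [Field F] [CharZero F] [Field K] [Algebra F K]
    [Field L] [Algebra K L] {n : ℕ} {σ : K ≃ₐ[F] K} {r₀ : sl (Fin n) L ⊗[L] sl (Fin n) L} (hr₀ : r₀ ∈ cartanTensor n L)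
    (hskew : r₀ + flip r₀ = casimirCartan n L) {γ : L ≃+* L}
    (hγ : ∀ k, γ (algebraMap K L k) = algebraMap K L (σ k))
    (hcoeff : ∀ i j, γ (cartanCoeff r₀ i j)
      = cartanCoeff (casimirCartan n L) i j - cartanCoeff r₀ i j)
    (hrat : ∀ i j, ∃ c : K, algebraMap K L c = cartanCoeff r₀ i j) :
    ∃ rs ∈ cartanTensor n K, rs + flip rs = 0 ∧
      r₀ = slMap₂ (algebraMap K L) rs + (2 : L)⁻¹ • casimirCartan n L ∧
      slMap₂ (σ : K →+* K) rs = -rs := by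
  have : CharZero K := charZero_of_injective_algebraMap (algebraMap F K).injective
  have : CharZero L := charZero_of_injective_algebraMap (algebraMap K L).injective
  choose c hc using hrat
  -- The coefficients of r₀ − Ω₀/2; as Ω₀ is rational, γ(r₀) = Ω₀ − r₀ becomes σ(b) = −b.
  let b (i j : Fin n) : K := c i j - 2⁻¹ * cartanCoeff (casimirCartan n K) i j
  have hb (i j) : algebraMap K L (b i j)
      = cartanCoeff r₀ i j - 2⁻¹ * cartanCoeff (casimirCartan n L) i j := by
    simp only [b, map_sub, map_mul, map_inv₀, map_ofNat, hc,
      map_cartanCoeff_casimirCartan]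
  have hbσ (i j) : σ (b i j) = -b i j := by
    apply (algebraMap K L).injective
    have h := map_cartanCoeff_casimirCartan (γ : L →+* L) i j
    rw [RingEquiv.coe_toRingHom] at h
    rw [← hγ, map_neg, hb, map_sub, map_mul, hcoeff, h, map_inv₀, map_ofNat]
    ring
  have hb' (i j) : b i j + b j i = 0 := by
    apply (algebraMap K L).injective
    have h := cartanCoeff_add r₀ (flip r₀) i j
    have hs := cartanCoeff_flip (casimirCartan n L) i j
    have hc : flip (casimirCartan n L) = casimirCartan n L := by
      rw [← hskew, map_add, flip_flip, add_comm]
    rw [hc] at hs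
    rw [cartanCoeff_flip] at h
    rw [hskew] at h
    rw [map_add, hb, hb, ← hs, map_zero]
    linear_combination -h
  refine ⟨∑ i, ∑ j, b i j • (cartanProj K i ⊗ₜ[K] cartanProj K j), sum_cartanProj_mem b, ?_, ?_, ?_⟩
  · rw [flip_sum_cartanProj]
    simp only [← Finset.sum_add_distrib, ← add_smul, hb', zero_smul, Finset.sum_const_zero]
  · rw [slMap₂_sum_cartanProj, eq_sum_cartanCoeff (casimirCartan_mem (n := n) (R := L))]
    conv_lhs => rw [eq_sum_cartanCoeff hr₀]
    simp only [Finset.smul_sum, ← Finset.sum_add_distrib, smul_smul, ← add_smul, hb, sub_add_cancel]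
  · rw [slMap₂_sum_cartanProj]
    simp only [RingHom.coe_coe, hbσ, neg_smul, Finset.sum_neg_distrib]

end SuBialgebra

theorem mainTheorem9 {F K L : Type*} [Field F] [CharZero F] [Field K] [Algebra F K]
    [Field L] [Algebra F L] [Algebra K L] [IsScalarTower F K L] [IsAlgClosure F L]
    (n : ℕ) (d : F) (hd : ¬ IsSquare d)
    (sqrtd : K) (hsqrtd : sqrtd ^ 2 = algebraMap F K d)
    (hK : IntermediateField.adjoin F {sqrtd} = ⊤)
    (σ : K ≃ₐ[F] K) (hσ : σ ≠ AlgEquiv.refl)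
    (T : SuBialgebra.AdmissibleTriple n)
    (rBD : sl (Fin n) L ⊗[L] sl (Fin n) L) (hBD : SuBialgebra.IsBelavinDrinfeld T rBD)
    (δ : SuBialgebra.su n σ →ₗ[F] SuBialgebra.su n σ ⊗[F] SuBialgebra.su n σ)
    (hδ : SuBialgebra.IsLieBialgebra δ)
    (δL : sl (Fin n) L →ₗ[L] sl (Fin n) L ⊗[L] sl (Fin n) L)
    (hδL : SuBialgebra.IsScalarExtension δ δL)
    (hgauge : SuBialgebra.GaugeEquivalent
      (SuBialgebra.coboundary (algebraMap K L sqrtd • rBD)) δL) :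
    (T.Γ₁ = ∅ ∧ T.Γ₂ = ∅) ∧
    (∃ rs : sl (Fin n) K ⊗[K] sl (Fin n) K,
      rs ∈ SuBialgebra.cartanTensor n K ∧
      rs + SuBialgebra.flip rs = 0 ∧
      rBD = SuBialgebra.slMap₂ (algebraMap K L) rs + SuBialgebra.drinfeldJimbo n L ∧
      SuBialgebra.slMap₂ (σ : K →+* K) rs = -rs) ∧
    (∃ X : GL (Fin n) K, δL = SuBialgebra.coboundary (algebraMap K L sqrtd •
      SuBialgebra.Ad₂ (X.map (algebraMap K L)) rBD)) ∧
    (∀ X : GL (Fin n) K, δL = SuBialgebra.coboundary (algebraMap K L sqrtd •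
        SuBialgebra.Ad₂ (X.map (algebraMap K L)) rBD) →
      ∃ c : Fin n → Fˣ,
        (X.1.map σ).transpose * X.1 = Matrix.diagonal fun i => algebraMap F K (c i)) := by
  open SuBialgebra in
  have hK0 : CharZero K := charZero_of_injective_algebraMap (algebraMap F K).injective
  have hL0 : CharZero L := charZero_of_injective_algebraMap (algebraMap K L).injective
  have hFL : IsGalois F L := IsAlgClosure.isGalois F L
  have hKL : IsGalois K L := IsGalois.tower_top_of_isGalois F K L
  have hq0 : sqrtd ≠ 0 := by
    rintro rfl
    rw [zero_pow two_ne_zero, eq_comm, map_eq_zero] at hsqrtd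
    exact hd (hsqrtd ▸ IsSquare.zero)
  have hσq := apply_eq_neg hsqrtd hK hσ
  obtain ⟨-, r₀, e, he, rfl, hr₀, hskew, -⟩ := hBD
  obtain ⟨w, hw⟩ := hasBDForm T he hr₀ hskew
  set r := r₀ + positivePart e + wedgePart T e with hr
  have hadd := hw.add_adjoint
  let γ₀ : L ≃+* L := (σ.liftNormal L).toRingEquiv
  have hγ₀ (k : K) : γ₀ (algebraMap K L k) = algebraMap K L (σ k) := σ.liftNormal_commutes L k
  have hherm (γ : L ≃+* L) (hγ : ∀ k, γ (algebraMap K L k) = algebraMap K L (σ k))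
      (X : GL (Fin n) L) (hX : δL = coboundary (algebraMap K L sqrtd • Ad₂ X r)) :=
    toOp_conj_transpose hq0 hσq hγ (hX ▸ hδL) hadd
  obtain ⟨X₀, hX₀⟩ := hgauge
  rw [Ad₂_comp_coboundary, map_smul] at hX₀
  have hT : T.Γ₁ = ∅ :=
    hw.Γ₁_eq_empty (γ₀ : L →+* L) (conj_mul_conj_eq_one γ₀ X₀) (hherm γ₀ hγ₀ X₀ hX₀)
  have hcoeff (γ : L ≃+* L) (hγ : ∀ k, γ (algebraMap K L k) = algebraMap K L (σ k)) :=
    hw.map_cartanCoeff (γ : L →+* L) (conj_mul_conj_eq_one γ X₀) (hherm γ hγ X₀ hX₀)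
  have hfix (γ : L ≃ₐ[K] L) (i j : Fin n) : γ (cartanCoeff r₀ i j) = cartanCoeff r₀ i j := by
    have hγ (k : K) : γ (γ₀ (algebraMap K L k)) = algebraMap K L (σ k) := by
      rw [hγ₀, γ.commutes]
    -- Both γ₀ and γ ∘ γ₀ extend σ, so both send the coefficient c to Ω₀ − c; comparing them shows
    -- that γ fixes c.
    have h : γ (γ₀ (cartanCoeff r₀ i j)) = _ := hcoeff (γ₀.trans γ.toRingEquiv) hγ i j
    have h₀ : γ₀ (cartanCoeff r₀ i j) = _ := hcoeff γ₀ hγ₀ i j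
    have h₁ : γ (cartanCoeff (casimirCartan n L) i j) = _ :=
      map_cartanCoeff_casimirCartan (γ : L →+* L) i j
    rw [h₀, map_sub, h₁] at h
    exact sub_right_injective h
  have hrat (i j : Fin n) : ∃ c : K, algebraMap K L c = cartanCoeff r₀ i j :=
    (InfiniteGalois.mem_range_algebraMap_iff_fixed _).mpr fun γ => hfix γ i j
  refine ⟨⟨hT, ?_⟩, ?_, ?_, ?_⟩
  · rw [← T.bijOn.image_eq, hT, Set.image_empty]
  · obtain ⟨rs, h₁, h₂, h₃, h₄⟩ := exists_skew_tensor hr₀ hskew hγ₀ (hcoeff γ₀ hγ₀) hrat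
    refine ⟨rs, h₁, h₂, ?_, h₄⟩
    rw [hr, wedgePart_eq_zero hT, add_zero, h₃, drinfeldJimbo, positivePart_eq he, add_assoc]
  · have hcol (γ : L ≃ₐ[K] L) :
        ∃ u : Matrix (Fin n) (Fin n) L, u.IsDiag ∧ X₀.1.map γ = X₀.1 * u := by
      have hmap := toOp_conj_map hq0 hσq (γ := γ.toRingEquiv) γ.commutes (hX₀ ▸ hδL) hadd
      have huv : X₀⁻¹.1 * X₀.1.map γ * (X₀⁻¹.1.map γ * X₀.1) = 1 := by
        have h : X₀.1.map γ * X₀⁻¹.1.map γ = (X₀.1 * X₀⁻¹.1).map γ := Matrix.map_mul.symm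
        rw [mul_assoc, ← mul_assoc _ _ X₀.1, h, Units.mul_inv,
          Matrix.map_one _ (map_zero γ) (map_one γ), one_mul, Units.inv_mul]
      refine ⟨_, (hw.isDiag_of_commute huv fun x => ?_).1, ?_⟩
      · have h := hmap (x.map γ.symm)
        rw [← hw.apply_map hT γ.toRingEquiv (hfix γ)] at h
        have hx : (x.map γ.symm).map γ.toRingEquiv = x := by
          ext i j
          exact γ.apply_symm_apply _
        rw [hx] at h
        exact h
      · rw [Units.mul_inv_cancel_left]
    obtain ⟨X, D, hD, hD', hX⟩ := exists_map_eq_mul_diagonal X₀ hcol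
    exact ⟨X, by rw [hX, Ad₂_mul_of_isDiag hw hT X₀ D hD hD', hX₀]⟩
  · intro X hX
    have hdiag := (hw.isDiag_of_intertwine (γ₀ : L →+* L) (conj_mul_conj_eq_one γ₀ _)
      (hherm γ₀ hγ₀ _ hX)).2
    set Y := (X.1.map σ).transpose * X.1 with hY
    have hYL : Y.map (algebraMap K L) = ((X.map (algebraMap K L)).1.map γ₀).transpose
        * (X.map (algebraMap K L)).1 := by
      rw [hY, Matrix.map_mul]
      congr 1
      ext i j
      exact (hγ₀ _).symm
    have hYdiag : Y.IsDiag := by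
      intro i j hij
      have h := hdiag hij
      apply (algebraMap K L).injective
      rw [map_zero, ← h]
      exact congrFun (congrFun hYL i) j
    -- X*X is Hermitian, so its diagonal entries are fixed by σ.
    have hYσ (i : Fin n) : σ (Y i i) = Y i i := by
      simp only [hY, Matrix.mul_apply, Matrix.transpose_apply, Matrix.map_apply, map_sum, map_mul,
        apply_apply_eq hsqrtd hK hσq]
      exact Finset.sum_congr rfl fun k _ => mul_comm _ _
    have hYunit : IsUnit Y := by
      refine IsUnit.mul ?_ X.isUnit
      rw [Matrix.isUnit_transpose]
      exact X.isUnit.map (σ : K →+* K).mapMatrix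
    have hYne (i : Fin n) : Y i i ≠ 0 := by
      intro h
      rw [Matrix.isUnit_iff_isUnit_det, isUnit_iff_ne_zero, ← hYdiag.diagonal_diag,
        Matrix.det_diagonal] at hYunit
      exact hYunit (Finset.prod_eq_zero (Finset.mem_univ i) h)
    choose c hc using fun i => mem_range_of_apply_eq hsqrtd hK hq0 hσq (hYσ i)
    refine ⟨fun i => Units.mk0 (c i) fun h => hYne i (by rw [← hc, h, map_zero]), ?_⟩
    refine hYdiag.diagonal_diag.symm.trans (congrArg _ (funext fun i => ?_))
    exact (hc i).symm
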